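/- Let $k$ be a perfect field of characteristic $p>0$, $W(k)$ its ring of Witt vectors, $G$ a finite group, $\rho\colon G\to \mathrm{Aut}_k\,k[[t]]$ an injective homomorphism, and $N$ a normal subgroup of $G$. Let $\mathcal C$ be the category of local artinian $W(k)$-algebras with residue field $k$ and local homomorphisms of $W(k)$-algebras, and $\hat{\mathcal C}$ the category of complete local noetherian $W(k)$-algebras with residue field $k$. For $R$ in $\hat{\mathcal C}$ put $h_R=\mathrm{Hom}_{W(k)}(R,\cdot)\colon\mathcal C\to\mathbf{Sets}$ (local homomorphisms; locality is automatic). A functor $D\colon\mathcal C\to\mathbf{Sets}$ is pro-representable if $D\cong h_R$ for some $R$ in $\hat{\mathcal C}$. A morphism $D\to E$ of functors is smooth if $D(A')\to D(A)\times_{E(A)}E(A')$ is surjective for every surjection $A'\to A$ in $\mathcal C$. A smooth morphism $h_R\to D$ which is bijective on $k[\varepsilon]$-points $(\varepsilon^2=0)$ is called a versal hull of $D$, and $R$ a versal deformation ring of $D$. For $A$ in $\mathcal C$ let $D_G(A)$ be the set of homomorphisms $\rho_A\colon G\to\mathrm{Aut}_A\,A[[t]]$ reducing to $\rho$ modulo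 $\mathfrak m_A$, up to conjugation by elements of $\ker(\mathrm{Aut}_A A[[t]]\to \mathrm{Aut}_k k[[t]])$; let $D_N$ be the same functor for $\rho|_N$. The group $G/N$ acts on $D_N$ as follows: for $g\in G$, $g_*[\rho_A]$ is the class of $n\mapsto r_g\,\rho_A(g^{-1}ng)\,r_g^{-1}$, where $r_g\in \mathrm{Aut}_A A[[t]]$ is any lift of $\rho(g)$. Restriction of homomorphisms to $N$ defines a morphism of functors $\mathrm{res}\colon D_G\to D_N^{G/N}$ into the subfunctor of $G/N$-invariant elements. **Theorem.** Suppose that the order of $G/N$ is prime to $p$ and that $D_N$ is pro-representable. Then: 1. $\mathrm{res}\colon D_G\to D_N^{G/N}$ is an isomorphism of functors. 2. $D_G$ is pro-representable. 3. Let $\varphi_G\colon h_{R_G}\to D_G$ and $\varphi_N\colon h_{R_N}\to D_N$ be versal hulls. There is a unique right action of $G/N$ on $R_N$ by $W(k)$-algebra automorphisms, $g\mapsto\alpha_g$, with $\varphi_N(f\circ\alpha_g)=g_*\varphi_N(f)$ for all $A$ in $\mathcal C$, all $f\in h_{R_N}(A)$ and all $g\in G/N$. For this action there is an isomorphism of $W(k)$-algebras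 $$e\colon R_N/(\{\alpha_g(x)-x\mid g\in G/N,\ x\in R_N\})\ \xrightarrow{\ \sim\ }\ R_G,$$ compatible with restriction: $\varphi_N(f\circ e\circ\pi)=\mathrm{res}(\varphi_G(f))$ for all $A$ in $\mathcal C$ and $f\in h_{R_G}(A)$, where $\pi$ is the projection from $R_N$ onto the quotient. -/

import Mathlib

open CategoryTheory

universe u

namespace LocalDef

set_option linter.unusedSectionVars false

open scoped PowerSeries

/-! ### Automorphisms of `A⟦t⟧` and their functoriality in `A` -/

/-- The group `Γ_A = Aut_A A⟦t⟧` (multiplication is composition). -/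
abbrev PSAut (A : Type*) [CommRing A] : Type _ := A⟦X⟧ ≃ₐ[A] A⟦X⟧

section PSAut

variable {A B C : Type*} [CommRing A] [IsLocalRing A] [IsArtinianRing A]
  [CommRing B] [IsLocalRing B] [IsArtinianRing B]
  [CommRing C] [IsLocalRing C] [IsArtinianRing C]

theorem isNilpotent_of_mem {a : A} (ha : a ∈ IsLocalRing.maximalIdeal A) : IsNilpotent a := by
  obtain ⟨n, hn⟩ := (isArtinianRing_iff_isNilpotent_maximalIdeal A).mp inferInstance
  have h := Ideal.pow_mem_pow ha n
  rw [hn] at h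
  exact ⟨n, h⟩

theorem hasSubst_apply_X (γ : PSAut A) : PowerSeries.HasSubst (γ PowerSeries.X) := by
  change IsNilpotent (PowerSeries.constantCoeff (γ PowerSeries.X))
  have h : ¬ IsUnit (γ (PowerSeries.X : A⟦X⟧)) := by
    rw [MulEquiv.isUnit_map, PowerSeries.isUnit_iff_constantCoeff, PowerSeries.constantCoeff_X]
    exact not_isUnit_zero
  rw [PowerSeries.isUnit_iff_constantCoeff] at h
  exact isNilpotent_of_mem h

theorem hasSubst_map {a : A⟦X⟧} (ha : PowerSeries.HasSubst a) (f : A →+* B) :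
    PowerSeries.HasSubst (PowerSeries.map f a) := by
  change IsNilpotent (PowerSeries.constantCoeff _)
  have h : IsNilpotent (PowerSeries.constantCoeff a) := ha
  have h2 : PowerSeries.constantCoeff (PowerSeries.map f a) = f (PowerSeries.constantCoeff a) := by
    rw [← PowerSeries.coeff_zero_eq_constantCoeff_apply,
      ← PowerSeries.coeff_zero_eq_constantCoeff_apply, PowerSeries.coeff_map]
  exact h2.symm ▸ h.map f

/-- An `A`-algebra automorphism of `A⟦t⟧` is the substitution of the image of `t`. -/
theorem apply_eq_subst (γ : PSAut A) (F : A⟦X⟧) : γ F = F.subst (γ PowerSeries.X) := by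
  have ha := hasSubst_apply_X γ
  rw [← PowerSeries.coe_substAlgHom ha]
  have hpoly : ∀ P : Polynomial A, γ (P : A⟦X⟧) = PowerSeries.substAlgHom ha (P : A⟦X⟧) := by
    intro P
    have h : γ.toAlgHom.comp (Polynomial.coeToPowerSeries.algHom A) =
        (PowerSeries.substAlgHom ha).comp (Polynomial.coeToPowerSeries.algHom A) := by
      apply Polynomial.algHom_ext
      simp [Polynomial.coeToPowerSeries.algHom_apply, PowerSeries.substAlgHom_X ha]
    simpa [Polynomial.coeToPowerSeries.algHom_apply] using DFunLike.congr_fun h P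
  have key : ∀ n, PowerSeries.coeff n (γ F - PowerSeries.substAlgHom ha F) = 0 := by
    intro n
    obtain ⟨m, hm⟩ := (ha.eventually_coeff_pow_eq_zero n).exists
    have h1 : (PowerSeries.X : A⟦X⟧) ^ m ∣ F - (PowerSeries.trunc m F : A⟦X⟧) := by
      rw [PowerSeries.X_pow_dvd_iff]
      intro i hi
      rw [map_sub, Polynomial.coeff_coe, PowerSeries.coeff_trunc, if_pos hi, sub_self]
    obtain ⟨H, hH⟩ := h1
    have h2 : F = (PowerSeries.trunc m F : A⟦X⟧) + PowerSeries.X ^ m * H := by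
      rw [← hH]; ring
    have h3 : γ F - PowerSeries.substAlgHom ha F =
        (γ PowerSeries.X) ^ m * (γ H - PowerSeries.substAlgHom ha H) := by
      rw [h2, map_add, map_add, map_mul, map_mul, map_pow, map_pow, hpoly,
        PowerSeries.substAlgHom_X ha]
      ring
    have h4 : (PowerSeries.X : A⟦X⟧) ^ (n + 1) ∣ (γ PowerSeries.X) ^ m := by
      rw [PowerSeries.X_pow_dvd_iff]
      intro i hi
      exact hm i (by omega)
    exact PowerSeries.X_pow_dvd_iff.mp (h3 ▸ h4.mul_right _) n (by omega)
  exact sub_eq_zero.mp (PowerSeries.ext key)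

theorem psAut_ext {γ γ' : PSAut A} (h : γ PowerSeries.X = γ' PowerSeries.X) : γ = γ' := by
  ext1 F
  rw [apply_eq_subst, apply_eq_subst γ', h]

/-- The automorphism `F ↦ F(a(t))`, where `a` and `b` are mutually inverse under composition. -/
noncomputable def substAut (a b : A⟦X⟧) (ha : PowerSeries.HasSubst a)
    (hb : PowerSeries.HasSubst b) (hab : a.subst b = PowerSeries.X)
    (hba : b.subst a = PowerSeries.X) : PSAut A :=
  AlgEquiv.ofAlgHom (PowerSeries.substAlgHom ha) (PowerSeries.substAlgHom hb)
    (by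
      ext1 F
      simp only [AlgHom.comp_apply, PowerSeries.coe_substAlgHom, AlgHom.id_apply]
      rw [PowerSeries.subst_comp_subst_apply hb ha, hba, PowerSeries.X_subst])
    (by
      ext1 F
      simp only [AlgHom.comp_apply, PowerSeries.coe_substAlgHom, AlgHom.id_apply]
      rw [PowerSeries.subst_comp_subst_apply ha hb, hab, PowerSeries.X_subst])

theorem substAut_X (a b : A⟦X⟧) (ha : PowerSeries.HasSubst a)
    (hb : PowerSeries.HasSubst b) (hab : a.subst b = PowerSeries.X)
    (hba : b.subst a = PowerSeries.X) : substAut a b ha hb hab hba PowerSeries.X = a := by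
  change PowerSeries.substAlgHom ha PowerSeries.X = a
  exact PowerSeries.substAlgHom_X ha

theorem map_subst_inv (f : A →+* B) (γ : PSAut A) :
    (PowerSeries.map f (γ PowerSeries.X)).subst (PowerSeries.map f (γ⁻¹ PowerSeries.X)) =
      (PowerSeries.X : B⟦X⟧) := by
  have h := PowerSeries.map_subst (hasSubst_apply_X γ⁻¹) (h := f) (γ PowerSeries.X)
  refine Eq.trans h.symm ?_
  rw [← apply_eq_subst]
  change PowerSeries.map f (γ.symm (γ PowerSeries.X)) = _
  simp

/-- The base change of an automorphism `γ` of `A⟦t⟧` along `f : A → B`: the automorphism of `B⟦t⟧`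
sending `t` to the image of `γ(t)`. It is characterised by `autMap_map`. -/
noncomputable def autMap (f : A →+* B) : PSAut A →* PSAut B where
  toFun γ := substAut (PowerSeries.map f (γ PowerSeries.X)) (PowerSeries.map f (γ⁻¹ PowerSeries.X))
    (hasSubst_map (hasSubst_apply_X γ) f) (hasSubst_map (hasSubst_apply_X γ⁻¹) f)
    (map_subst_inv f γ) (by simpa using map_subst_inv f γ⁻¹)
  map_one' := psAut_ext (by simp [substAut_X])
  map_mul' γ δ := psAut_ext (by
    rw [substAut_X, AlgEquiv.mul_apply, AlgEquiv.mul_apply, substAut_X, apply_eq_subst,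
      apply_eq_subst (substAut _ _ _ _ _ _), substAut_X]
    exact PowerSeries.map_subst (hasSubst_apply_X γ) (h := f) (δ PowerSeries.X))

theorem autMap_X (f : A →+* B) (γ : PSAut A) :
    autMap f γ PowerSeries.X = PowerSeries.map f (γ PowerSeries.X) :=
  substAut_X _ _ (hasSubst_map (hasSubst_apply_X γ) f) (hasSubst_map (hasSubst_apply_X γ⁻¹) f)
    (map_subst_inv f γ) (by simpa using map_subst_inv f γ⁻¹)

theorem autMap_map (f : A →+* B) (γ : PSAut A) (F : A⟦X⟧) :
    autMap f γ (PowerSeries.map f F) = PowerSeries.map f (γ F) := by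
  rw [apply_eq_subst, autMap_X, apply_eq_subst γ F]
  exact (PowerSeries.map_subst (hasSubst_apply_X γ) (h := f) F).symm

theorem autMap_id (γ : PSAut A) : autMap (RingHom.id A) γ = γ :=
  psAut_ext (by rw [autMap_X]; simp)

theorem autMap_comp (g : B →+* C) (f : A →+* B) (γ : PSAut A) :
    autMap (g.comp f) γ = autMap g (autMap f γ) :=
  psAut_ext (by rw [autMap_X, autMap_X, autMap_X, PowerSeries.map_comp]; rfl)

/-- Automorphisms lift along surjections. -/
theorem autMap_surjective {k : Type*} [Field k] (f : A →+* k) (hf : Function.Surjective f) :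
    Function.Surjective (autMap f) := by
  intro γ
  set a : k⟦X⟧ := γ PowerSeries.X with ha
  set b : k⟦X⟧ := γ⁻¹ PowerSeries.X with hb
  have ha0 : PowerSeries.constantCoeff a = 0 := by
    have h : IsNilpotent (PowerSeries.constantCoeff a) := hasSubst_apply_X γ
    exact h.eq_zero
  have hb0 : PowerSeries.constantCoeff b = 0 := by
    have h : IsNilpotent (PowerSeries.constantCoeff b) := hasSubst_apply_X γ⁻¹
    exact h.eq_zero
  have ha1 : PowerSeries.coeff 1 a ≠ 0 := by
    intro h
    have h2 : (PowerSeries.X : k⟦X⟧) ^ 2 ∣ a := by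
      rw [PowerSeries.X_pow_dvd_iff]
      intro m hm
      interval_cases m
      · simpa using ha0
      · exact h
    have h3 : (PowerSeries.X : k⟦X⟧) ∣ b := PowerSeries.X_dvd_iff.mpr hb0
    have h4 : b ^ 2 ∣ PowerSeries.X := by
      have := map_dvd γ⁻¹ h2
      rw [map_pow, ← hb, ha] at this
      simpa [← AlgEquiv.mul_apply] using this
    have h5 := PowerSeries.X_pow_dvd_iff.mp ((pow_dvd_pow_of_dvd h3 2).trans h4) 1 (by omega)
    simp at h5
  choose s hs using hf
  let c : A⟦X⟧ := PowerSeries.mk fun n => if n = 0 then 0 else s (PowerSeries.coeff n a)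
  have hc0 : PowerSeries.constantCoeff c = 0 := by
    rw [← PowerSeries.coeff_zero_eq_constantCoeff_apply]; simp [c]
  have hc1 : IsUnit (PowerSeries.coeff 1 c) := by
    have h : f (PowerSeries.coeff 1 c) ≠ 0 := by simpa [c, hs] using ha1
    by_contra hu
    have h2 : PowerSeries.coeff 1 c ∈ IsLocalRing.maximalIdeal A := hu
    exact h ((isNilpotent_of_mem h2).map f).eq_zero
  refine ⟨substAut c (c.substInvOfIsUnit hc1) (PowerSeries.HasSubst.of_constantCoeff_zero' hc0)
    (PowerSeries.HasSubst.substInvOfIsUnit c hc1)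
    (PowerSeries.subst_substInvOfIsUnit_right c hc0 hc1)
    (PowerSeries.subst_substInvOfIsUnit_left c hc0 hc1), psAut_ext ?_⟩
  rw [autMap_X, substAut_X]
  ext n
  rw [PowerSeries.coeff_map]
  by_cases hn : n = 0
  · subst hn
    simpa [c] using ha0.symm
  · simp [c, hn, hs, a]

end PSAut

/-! ### The coefficient rings -/

section Rings

variable (p : ℕ) [Fact p.Prime] (k : Type u) [Field k] [CharP k p]

/-- The objects of the category `𝒞`: local artinian `W(k)`-algebras with residue field `k`, that is,
with a (necessarily unique) surjection onto `k` of `W(k)`-algebras. -/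
structure ArtAlg : Type (u + 1) where
  carrier : Type u
  [commRing : CommRing carrier]
  [algebra : Algebra (WittVector p k) carrier]
  [isLocalRing : IsLocalRing carrier]
  [isArtinianRing : IsArtinianRing carrier]
  residue : carrier →+* k
  residue_algebraMap : ∀ w, residue (algebraMap (WittVector p k) carrier w) =
    WittVector.constantCoeff w

/-- The objects of the category `𝒞̂`: complete local noetherian `W(k)`-algebras with
residue field `k`. -/
structure CompAlg : Type (u + 1) where
  carrier : Type u
  [commRing : CommRing carrier]
  [algebra : Algebra (WittVector p k) carrier]
  [isLocalRing : IsLocalRing carrier]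
  [isNoetherianRing : IsNoetherianRing carrier]
  [isAdicComplete : IsAdicComplete (IsLocalRing.maximalIdeal carrier) carrier]
  residue : carrier →+* k
  residue_algebraMap : ∀ w, residue (algebraMap (WittVector p k) carrier w) =
    WittVector.constantCoeff w

variable {p k}

attribute [instance] ArtAlg.commRing ArtAlg.algebra ArtAlg.isLocalRing ArtAlg.isArtinianRing
  CompAlg.commRing CompAlg.algebra CompAlg.isLocalRing CompAlg.isNoetherianRing
  CompAlg.isAdicComplete

instance : CoeSort (ArtAlg p k) (Type u) := ⟨ArtAlg.carrier⟩

instance : CoeSort (CompAlg p k) (Type u) := ⟨CompAlg.carrier⟩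

/-- Two homomorphisms of `W(k)`-algebras from a local ring to `k` agree. -/
theorem residue_unique {R : Type*} [CommRing R] [IsLocalRing R] [Algebra (WittVector p k) R]
    (f g : R →+* k)
    (hf : ∀ w, f (algebraMap (WittVector p k) R w) = WittVector.constantCoeff w)
    (hg : ∀ w, g (algebraMap (WittVector p k) R w) = WittVector.constantCoeff w) : f = g := by
  have hs : Function.Surjective g := fun x => by
    obtain ⟨w, hw⟩ := WittVector.constantCoeff_surjective (R := k) p x
    exact ⟨_, (hg w).trans hw⟩
  have hs' : Function.Surjective f := fun x => by
    obtain ⟨w, hw⟩ := WittVector.constantCoeff_surjective (R := k) p x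
    exact ⟨_, (hf w).trans hw⟩
  have h1 : RingHom.ker f = RingHom.ker g :=
    (IsLocalRing.eq_maximalIdeal (RingHom.ker_isMaximal_of_surjective f hs')).trans
      (IsLocalRing.eq_maximalIdeal (RingHom.ker_isMaximal_of_surjective g hs)).symm
  ext x
  obtain ⟨w, hw⟩ := WittVector.constantCoeff_surjective (R := k) p (f x)
  have h2 : x - algebraMap (WittVector p k) R w ∈ RingHom.ker f := by
    rw [RingHom.mem_ker, map_sub, hf, hw, sub_self]
  rw [h1, RingHom.mem_ker, map_sub, hg, hw, sub_eq_zero] at h2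
  exact h2.symm

/-- Homomorphisms of `W(k)`-algebras between objects of `𝒞` commute with the maps to `k`. -/
theorem residue_comp {A B : ArtAlg p k} (f : A →ₐ[WittVector p k] B) :
    B.residue.comp (f : A →+* B) = A.residue :=
  residue_unique _ _ (fun w => by simp [B.residue_algebraMap]) A.residue_algebraMap

/-- Homomorphisms of `W(k)`-algebras between objects of `𝒞` are automatically local. -/
theorem isLocalHom_art {A B : ArtAlg p k} (f : A →ₐ[WittVector p k] B) :
    IsLocalHom (f : A →+* B) where
  map_nonunit a ha := by
    by_contra h
    exact (isNilpotent_of_mem (A := A) h |>.map (f : A →+* B)).not_isUnit ha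

/-- Homomorphisms of `W(k)`-algebras from an object of `𝒞̂` to an object of `𝒞` are automatically
local. -/
theorem isLocalHom_comp {R : CompAlg p k} {A : ArtAlg p k} (f : R →ₐ[WittVector p k] A) :
    IsLocalHom (f : R →+* A) where
  map_nonunit a ha := by
    have h : A.residue.comp (f : R →+* A) = R.residue :=
      residue_unique _ _ (fun w => by simp [A.residue_algebraMap]) R.residue_algebraMap
    have h2 : R.residue a ≠ 0 := by
      rw [← h]
      exact (ha.map A.residue).ne_zero
    have hs : Function.Surjective R.residue := fun x => by
      obtain ⟨w, hw⟩ := WittVector.constantCoeff_surjective (R := k) p x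
      exact ⟨_, (R.residue_algebraMap w).trans hw⟩
    by_contra hu
    refine h2 ?_
    rw [← RingHom.mem_ker, IsLocalRing.eq_maximalIdeal
      (RingHom.ker_isMaximal_of_surjective R.residue hs)]
    exact hu

/-- The category `𝒞`; its morphisms are the local homomorphisms of `W(k)`-algebras, where locality
is automatic by `isLocalHom_art`. -/
noncomputable instance : Category (ArtAlg p k) where
  Hom A B := A →ₐ[WittVector p k] B
  id A := AlgHom.id _ A
  comp f g := AlgHom.comp g f

/-- The functor `h_R = Hom(R, ·)` on `𝒞`, where `R` is an object of `𝒞̂`. -/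
noncomputable def homFunctor (R : CompAlg p k) : ArtAlg p k ⥤ Type u where
  obj A := R →ₐ[WittVector p k] A
  map f := ↾fun x => AlgHom.comp f x

/-- The ring of dual numbers `k[ε]`, as an object of `𝒞`. -/
noncomputable def dual (p : ℕ) [Fact p.Prime] (k : Type u) [Field k] [CharP k p] : ArtAlg p k :=
  letI : Algebra (WittVector p k) (DualNumber k) :=
    ((TrivSqZeroExt.inlHom k k).comp WittVector.constantCoeff).toAlgebra
  haveI : IsArtinianRing (DualNumber k) :=
    haveI : Module.Finite k (DualNumber k) := inferInstanceAs (Module.Finite k (k × k))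
    IsArtinianRing.of_finite k (DualNumber k)
  { carrier := DualNumber k
    residue := (TrivSqZeroExt.fstHom k k k).toRingHom
    residue_algebraMap := fun _ => rfl }

/-- `D` is pro-representable. -/
def IsProRepresentable (D : ArtAlg p k ⥤ Type u) : Prop :=
  ∃ R : CompAlg p k, Nonempty (homFunctor R ≅ D)

/-- A morphism of functors `D → E` is smooth if `D(A') → D(A) ×_{E(A)} E(A')` is surjective for
every surjective morphism `A' → A`. -/
def IsSmooth {D E : ArtAlg p k ⥤ Type u} (φ : D ⟶ E) : Prop :=
  ∀ (A' A : ArtAlg p k) (f : A' ⟶ A),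
    Function.Surjective (show A' →ₐ[WittVector p k] A from f) →
    ∀ (x : D.obj A) (y : E.obj A'), φ.app A x = E.map f y →
      ∃ z : D.obj A', D.map f z = x ∧ φ.app A' z = y

/-- `φ : h_R → D` is a versal hull (so `R` is a versal deformation ring of `D`): it is smooth and
bijective on tangent spaces. -/
def IsVersalHull {R : CompAlg p k} {D : ArtAlg p k ⥤ Type u} (φ : homFunctor R ⟶ D) : Prop :=
  IsSmooth φ ∧ Function.Bijective (φ.app (dual p k))

/-- The subfunctor `D^Γ` of the elements invariant under an action of a group `Γ` on `D`. -/
def invariants {Γ : Type*} [Group Γ] (D : ArtAlg p k ⥤ Type u) (a : Γ →* End D) :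
    ArtAlg p k ⥤ Type u where
  obj A := {x : D.obj A // ∀ g, (a g).app A x = x}
  map f := ↾fun x => ⟨D.map f x.1, fun g => by
    have h := NatTrans.naturality_apply (a g) f x.1
    rw [x.2 g] at h
    exact h⟩

/-- The ideal generated by the elements `g x - x`, for an action of a group `Γ` on the right
on `R` by automorphisms of `W(k)`-algebras. -/
def coinvariantIdeal {Γ : Type*} [Group Γ] (R : CompAlg p k)
    (α : Γᵐᵒᵖ →* (R ≃ₐ[WittVector p k] R)) : Ideal R :=
  Ideal.span {y | ∃ (g : Γᵐᵒᵖ) (x : R), y = α g x - x}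

end Rings

/-! ### Deformation functors -/

section Deformations

variable {p : ℕ} [Fact p.Prime] {k : Type u} [Field k] [CharP k p]
  {G : Type u} [Group G] (ρ : G →* PSAut k)

/-- A lift of `ρ` to `A`: a homomorphism `G → Aut_A A⟦t⟧` reducing to `ρ`. -/
def Lift (A : ArtAlg p k) : Type u :=
  {σ : G →* PSAut A // ∀ g, autMap A.residue (σ g) = ρ g}

/-- Two lifts are equivalent if they are conjugate by an element of the kernel of
`Aut_A A⟦t⟧ → Aut_k k⟦t⟧`. -/
instance liftSetoid (A : ArtAlg p k) : Setoid (Lift ρ A) where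
  r σ σ' := ∃ χ : PSAut A, autMap A.residue χ = 1 ∧ ∀ g, σ'.1 g = χ * σ.1 g * χ⁻¹
  iseqv := by
    refine ⟨fun σ => ⟨1, map_one _, fun g => by simp⟩, ?_, ?_⟩
    · rintro σ σ' ⟨χ, h1, h2⟩
      exact ⟨χ⁻¹, by simp [h1], fun g => by rw [h2]; group⟩
    · rintro σ σ' σ'' ⟨χ, h1, h2⟩ ⟨χ', h1', h2'⟩
      exact ⟨χ' * χ, by simp [h1, h1'], fun g => by rw [h2', h2]; group⟩

variable {ρ} in
/-- The push-forward of a lift along a morphism of `𝒞`. -/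
noncomputable def Lift.map {A B : ArtAlg p k} (f : A ⟶ B) (σ : Lift ρ A) : Lift ρ B :=
  ⟨(autMap (show A →ₐ[WittVector p k] B from f : A →+* B)).comp σ.1, fun g => by
    rw [MonoidHom.comp_apply, ← autMap_comp, residue_comp, σ.2]⟩

/-- The infinitesimal deformation functor `D_ρ`. -/
noncomputable def defFunctor : ArtAlg p k ⥤ Type u where
  obj A := Quotient (liftSetoid ρ A)
  map {A B} f := ↾(Quotient.map (Lift.map f) (by
    rintro σ σ' ⟨χ, h1, h2⟩
    refine ⟨autMap (show A →ₐ[WittVector p k] B from f : A →+* B) χ, ?_, fun g => ?_⟩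
    · rw [← autMap_comp, residue_comp, h1]
    · simp [Lift.map, h2]))
  map_id A := by
    ext x
    induction x using Quotient.inductionOn with | _ σ
    refine congrArg (Quotient.mk _) (Subtype.ext (MonoidHom.ext fun g => ?_))
    exact autMap_id _
  map_comp {A B C} f g := by
    ext x
    induction x using Quotient.inductionOn with | _ σ
    refine congrArg (Quotient.mk _) (Subtype.ext (MonoidHom.ext fun g => ?_))
    exact autMap_comp _ _ _

variable (N : Subgroup G)

/-- The deformation functor `D_N` of the restriction of `ρ` to `N`. -/
noncomputable abbrev subFunctor : ArtAlg p k ⥤ Type u := defFunctor (ρ.comp N.subtype)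

/-- The restriction morphism `D_G → D_N`. -/
noncomputable def res : defFunctor (p := p) ρ ⟶ subFunctor ρ N where
  app A := ↾(Quotient.map
    (fun σ : Lift ρ A => (⟨σ.1.comp N.subtype, fun n => σ.2 n⟩ : Lift (ρ.comp N.subtype) A))
    (by
      rintro σ σ' ⟨χ, h1, h2⟩
      exact ⟨χ, h1, fun n => h2 n⟩))
  naturality A B f := by
    ext x
    induction x using Quotient.inductionOn with | _ σ
    rfl

variable [N.Normal]

variable {ρ N} in
/-- The lift `n ↦ r σ(g⁻¹ n g) r⁻¹` of `ρ|_N`, where `σ` is a lift of `ρ|_N` and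
`r` is a lift of `ρ(g)`. -/
noncomputable def conjLift {A : ArtAlg p k} (g : G) (r : PSAut A) (hr : autMap A.residue r = ρ g)
    (σ : Lift (ρ.comp N.subtype) A) : Lift (ρ.comp N.subtype) A :=
  ⟨(MulAut.conj r).toMonoidHom.comp (σ.1.comp (MulAut.conjNormal g⁻¹).toMonoidHom), fun n => by
    have h : autMap A.residue (σ.1 (MulAut.conjNormal g⁻¹ n)) = ρ (g⁻¹ * n * g⁻¹⁻¹) :=
      σ.2 (MulAut.conjNormal g⁻¹ n)
    change autMap A.residue (r * σ.1 (MulAut.conjNormal g⁻¹ n) * r⁻¹) = ρ n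
    rw [map_mul, map_mul, h, map_inv, hr, ← map_inv, ← map_mul, ← map_mul]
    congr 1
    group⟩

theorem conjLift_equiv {A : ArtAlg p k} (g : G) (r r' : PSAut A)
    (hr : autMap A.residue r = ρ g) (hr' : autMap A.residue r' = ρ g)
    (σ σ' : Lift (ρ.comp N.subtype) A) (hσ : σ ≈ σ') :
    conjLift g r hr σ ≈ conjLift g r' hr' σ' := by
  obtain ⟨χ, h1, h2⟩ := hσ
  refine ⟨r' * χ * r⁻¹, by simp [hr, hr', h1], fun n => ?_⟩
  change r' * σ'.1 _ * r'⁻¹ = (r' * χ * r⁻¹) * (r * σ.1 _ * r⁻¹) * (r' * χ * r⁻¹)⁻¹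
  rw [h2]
  group

theorem exists_lift (A : ArtAlg p k) (g : G) : ∃ r : PSAut A, autMap A.residue r = ρ g :=
  autMap_surjective A.residue (fun x => by
    obtain ⟨w, hw⟩ := WittVector.constantCoeff_surjective (R := k) p x
    exact ⟨_, (A.residue_algebraMap w).trans hw⟩) (ρ g)

/-- The operation `g_*` on `D_N(A)`, for `g` in `G`. -/
noncomputable def actFun (A : ArtAlg p k) (g : G) :
    (subFunctor ρ N).obj A → (subFunctor ρ N).obj A :=
  Quotient.map (conjLift g (exists_lift ρ A g).choose (exists_lift ρ A g).choose_spec)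
    fun σ σ' h => conjLift_equiv ρ N g _ _ _ _ σ σ' h

/-- `g_*` may be computed by means of any lift `r` of `ρ(g)`. -/
theorem actFun_mk (A : ArtAlg p k) (g : G) (r : PSAut A) (hr : autMap A.residue r = ρ g)
    (σ : Lift (ρ.comp N.subtype) A) :
    actFun ρ N A g (Quotient.mk _ σ) = Quotient.mk _ (conjLift g r hr σ) :=
  Quotient.sound (conjLift_equiv ρ N g _ _ _ _ σ σ (Setoid.refl σ))

/-- The action of `G` on the functor `D_N`. -/
noncomputable def actG : G →* End (subFunctor (p := p) ρ N) where
  toFun g :=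
    { app A := ↾(actFun ρ N A g)
      naturality A B f := by
        ext x
        induction x using Quotient.inductionOn with | _ σ
        obtain ⟨r, hr⟩ := exists_lift ρ A g
        have hr' : autMap B.residue (autMap (show A →ₐ[WittVector p k] B from f : A →+* B) r) =
            ρ g := by rw [← autMap_comp, residue_comp, hr]
        refine (actFun_mk ρ N B g _ hr' (Lift.map f σ)).trans ?_
        refine Eq.trans ?_ (congrArg ((subFunctor ρ N).map f) (actFun_mk ρ N A g r hr σ)).symm
        refine congrArg (Quotient.mk _) (Subtype.ext (MonoidHom.ext fun n => ?_))
        simp [conjLift, Lift.map] }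
  map_one' := by
    refine NatTrans.ext (funext fun A => ?_)
    ext x
    induction x using Quotient.inductionOn with | _ σ
    refine (actFun_mk ρ N A 1 1 (by simp) σ).trans ?_
    refine congrArg (Quotient.mk _) (Subtype.ext (MonoidHom.ext fun n => ?_))
    simp [conjLift]
  map_mul' g g' := by
    refine NatTrans.ext (funext fun A => ?_)
    ext x
    induction x using Quotient.inductionOn with | _ σ
    obtain ⟨r, hr⟩ := exists_lift ρ A g
    obtain ⟨r', hr'⟩ := exists_lift ρ A g'
    refine (actFun_mk ρ N A (g * g') (r * r') (by simp [hr, hr']) σ).trans ?_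
    refine Eq.trans ?_ (congrArg (actFun ρ N A g) (actFun_mk ρ N A g' r' hr' σ)).symm
    refine Eq.trans ?_ (actFun_mk ρ N A g r hr _).symm
    refine congrArg (Quotient.mk _) (Subtype.ext (MonoidHom.ext fun n => ?_))
    simp [conjLift]

theorem actG_eq_one (n : G) (hn : n ∈ N) : actG (p := p) ρ N n = 1 := by
  refine NatTrans.ext (funext fun A => ?_)
  ext x
  induction x using Quotient.inductionOn with | _ σ
  refine (actFun_mk ρ N A n (σ.1 ⟨n, hn⟩) (σ.2 ⟨n, hn⟩) σ).trans ?_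
  refine congrArg (Quotient.mk _) (Subtype.ext (MonoidHom.ext fun m => ?_))
  change σ.1 ⟨n, hn⟩ * σ.1 _ * (σ.1 ⟨n, hn⟩)⁻¹ = σ.1 m
  rw [← map_inv, ← map_mul, ← map_mul]
  congr 1
  ext
  simp [mul_assoc]

/-- The action of `G/N` on the functor `D_N`. -/
noncomputable def act : G ⧸ N →* End (subFunctor (p := p) ρ N) :=
  QuotientGroup.lift N (actG ρ N) (actG_eq_one ρ N)

theorem res_invariant (A : ArtAlg p k) (x : (defFunctor ρ).obj A) (g : G ⧸ N) :
    (act ρ N g).app A ((res ρ N).app A x) = (res ρ N).app A x := by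
  induction g using QuotientGroup.induction_on with | H g
  induction x using Quotient.inductionOn with | _ σ
  refine (actFun_mk ρ N A g (σ.1 g) (σ.2 g) _).trans ?_
  refine congrArg (Quotient.mk _) (Subtype.ext (MonoidHom.ext fun n => ?_))
  change σ.1 g * σ.1 _ * (σ.1 g)⁻¹ = σ.1 n
  rw [← map_inv, ← map_mul, ← map_mul]
  congr 1
  simp [mul_assoc]

/-- The restriction morphism `D_G → D_N^{G/N}`. -/
noncomputable def resInv : defFunctor (p := p) ρ ⟶ invariants (subFunctor ρ N) (act ρ N) where
  app A := ↾fun x => ⟨(res ρ N).app A x, res_invariant ρ N A x⟩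
  naturality A B f := by
    ext x
    refine Subtype.ext ?_
    exact NatTrans.naturality_apply (res ρ N) f x

variable {ρ N} in
/-- The right action `α` of `G/N` on `R` corresponds to the action of `G/N` on `D_N` under
the morphism `φ : h_R → D_N`: one has `φ(f ∘ α_g) = g_* φ(f)`. -/
def InducesAction {R : CompAlg p k} (φ : homFunctor R ⟶ subFunctor ρ N)
    (α : (G ⧸ N)ᵐᵒᵖ →* (R ≃ₐ[WittVector p k] R)) : Prop :=
  ∀ (g : G ⧸ N) (A : ArtAlg p k) (f : R →ₐ[WittVector p k] A),
    φ.app A (f.comp (α (MulOpposite.op g) : R →ₐ[WittVector p k] R)) =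
      (act ρ N g).app A (φ.app A f)

end Deformations

end LocalDef

open LocalDef

namespace LocalDef

set_option linter.unusedSectionVars false

open scoped PowerSeries

/-! ### Splittings and conjugacy for kernels filtered by `p`-torsion abelian groups -/

section CoprimeExtensions

variable {Q H : Type*} [Group Q] [Finite Q] [Group H]

/-! Write `Γ_A = Aut_A A⟦t⟧` and `K = ker(Γ_A → Γ_k)`. The automorphisms trivial modulo `m_A^i`
filter `K` by normal subgroups of `Γ_A`; the filtration is finite, and its successive quotients are
abelian and killed by `p` (`isPFiltration_congruenceSubgroup`). Since `|G/N|` is prime to `p`, the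
groups `H¹` and `H²` of `G/N` with values in these quotients vanish, so approximate homomorphisms
can be corrected, and approximately equal ones conjugated, one layer at a time
(`IsPFiltration.exists_hom`, `IsPFiltration.exists_conj`).

To reach `G` from `N`, fix a lift `σ` of `ρ|_N` and let `E ⊆ Γ_A × G` consist of the pairs `(r, g)`
with `r` lifting `ρ(g)` and conjugation by `r` acting on `σ` as `g` does. The graph of `σ` is normal
in `E`. Invariance of the class of `σ` says that `E → G` is surjective; then `E/graph(σ)` is an
extension of `G/N` by a group with a filtration as above. A splitting of it is an extension of `σ`
to `G` (`exists_extension`), and conjugacy of splittings is uniqueness (`exists_conj_of_eq_on`).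
Hence `res` is bijective.

The rest is formal. Morphisms `h_R → h_S` come from ring homomorphisms `S → R`
(`CompAlg.exists_comp_eq`), a versal hull of a pro-representable functor is an isomorphism
(`IsVersalHull.isIso`), and the invariants of `h_R` are represented by the coinvariants of `R`
(`isIso_coinvariantsHom`). -/

theorem zpow_card_mul_of_coprime {M : Type*} [CommGroup M] {m p : ℕ} (hmp : m.Coprime p)
    (hexp : ∀ x : M, x ^ p = 1) : ∃ l : ℤ, ∀ x : M, (x ^ m) ^ l = x := by
  refine ⟨Nat.gcdA m p, fun x => ?_⟩
  have h := Nat.gcd_eq_gcd_ab m p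
  rw [hmp.gcd_eq_one] at h
  have h2 : x ^ ((m : ℤ) * m.gcdA p + p * m.gcdB p) = x := by rw [← h]; simp
  rw [zpow_add, zpow_mul, zpow_mul, zpow_natCast, zpow_natCast, hexp, one_zpow, mul_one] at h2
  exact h2

/-- If `M` is abelian and `|Q|` is invertible on `M`, a map `Q → H` multiplicative modulo `M` can be
corrected by elements of `M` to a homomorphism. -/
theorem exists_hom_of_abelian_kernel (M : Subgroup H) [M.Normal]
    (hcomm : ∀ x ∈ M, ∀ y ∈ M, x * y = y * x) {p : ℕ} (hexp : ∀ x ∈ M, x ^ p = 1)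
    (hp : (Nat.card Q).Coprime p) (s : Q → H) (hs : ∀ x y, s x * s y * (s (x * y))⁻¹ ∈ M) :
    ∃ t : Q →* H, ∀ x, t x * (s x)⁻¹ ∈ M := by
  classical
  have := Fintype.ofFinite Q
  let _ : CommGroup M := { (inferInstance : Group M) with
    mul_comm := fun a b => Subtype.ext (hcomm a a.2 b b.2) }
  obtain ⟨l, hl⟩ := zpow_card_mul_of_coprime (M := M) hp fun x => Subtype.ext (hexp x x.2)
  let c : Q → Q → M := fun x y => ⟨_, hs x y⟩
  let a : Q → M →* M := fun x => (MulAut.conjNormal (s x) : MulAut M).toMonoidHom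
  have ha : ∀ x (m : M), ((a x m : M) : H) = s x * m * (s x)⁻¹ := fun x m => rfl
  have hcv : ∀ x y, ((c x y : M) : H) = s x * s y * (s (x * y))⁻¹ := fun x y => rfl
  have hc : ∀ x y z, c x y * c (x * y) z = a x (c y z) * c x (y * z) := by
    intro x y z
    refine Subtype.ext ?_
    simp only [Subgroup.coe_mul, ha, hcv, mul_assoc x y z]
    group
  -- Multiplying the 2-cocycle identity over the last variable shows that `c ^ |Q|` is the
  -- coboundary of `b`. On `M` the power `l` inverts the power `|Q|`, so `c` itself is the
  -- coboundary of `b ^ l`.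
  let b : Q → M := fun x => ∏ z, c x z
  have hb : ∀ x y, c x y ^ Nat.card Q * b (x * y) = a x (b y) * b x := by
    intro x y
    have h1 : ∏ z, c x (y * z) = b x := Fintype.prod_equiv (Equiv.mulLeft y) _ _ fun z => rfl
    have h2 : ∏ z, c x y * c (x * y) z = ∏ z, a x (c y z) * c x (y * z) :=
      Finset.prod_congr rfl fun z _ => hc x y z
    rw [Finset.prod_mul_distrib, Finset.prod_mul_distrib, h1, ← map_prod, Finset.prod_const,
      Finset.card_univ, ← Nat.card_eq_fintype_card] at h2
    exact h2
  have hd : ∀ x y, (b x ^ l)⁻¹ * a x (b y ^ l)⁻¹ * c x y = (b (x * y) ^ l)⁻¹ := by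
    intro x y
    have h := congrArg (fun m => m ^ l) (hb x y)
    simp only [mul_zpow, hl] at h
    rw [map_inv, map_zpow, eq_mul_inv_of_mul_eq h, ← mul_inv, mul_comm (a x (b y) ^ l),
      inv_mul_cancel_left]
  refine ⟨MonoidHom.mk' (fun x => ((b x ^ l)⁻¹ : M) * s x) fun x y => ?_, fun x => ?_⟩
  · have h := congrArg (Subtype.val) (hd x y)
    simp only [Subgroup.coe_mul, ha, hcv] at h
    rw [← h]
    group
  · simpa [MonoidHom.mk'_apply] using zpow_mem (b x).2 l

/-- If `M` is abelian and `|Q|` is invertible on `M`, two homomorphisms `Q → H` which agree modulo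
`M` are conjugate by an element of `M`. -/
theorem exists_conj_of_abelian_kernel (M : Subgroup H) [M.Normal]
    (hcomm : ∀ x ∈ M, ∀ y ∈ M, x * y = y * x) {p : ℕ} (hexp : ∀ x ∈ M, x ^ p = 1)
    (hp : (Nat.card Q).Coprime p) (s t : Q →* H) (hst : ∀ x, t x * (s x)⁻¹ ∈ M) :
    ∃ c ∈ M, ∀ x, t x = c * s x * c⁻¹ := by
  classical
  have := Fintype.ofFinite Q
  let _ : CommGroup M := { (inferInstance : Group M) with
    mul_comm := fun a b => Subtype.ext (hcomm a a.2 b b.2) }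
  obtain ⟨l, hl⟩ := zpow_card_mul_of_coprime (M := M) hp fun x => Subtype.ext (hexp x x.2)
  let d : Q → M := fun x => ⟨_, hst x⟩
  let a : Q → M →* M := fun x => (MulAut.conjNormal (s x) : MulAut M).toMonoidHom
  have ha : ∀ x (m : M), ((a x m : M) : H) = s x * m * (s x)⁻¹ := fun x m => rfl
  have hdv : ∀ x, ((d x : M) : H) = t x * (s x)⁻¹ := fun x => rfl
  have hd : ∀ x y, d (x * y) = d x * a x (d y) := by
    intro x y
    refine Subtype.ext ?_
    simp only [Subgroup.coe_mul, ha, hdv, map_mul]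
    group
  -- `d` is a crossed homomorphism; multiplying its identity over `y` makes `d ^ |Q|` principal,
  -- given by `b`, hence `d` is principal, given by `b ^ l`.
  let b : M := ∏ y, d y
  have hb : ∀ x, b = d x ^ Nat.card Q * a x b := by
    intro x
    have h1 : ∏ y, d (x * y) = b := Fintype.prod_equiv (Equiv.mulLeft x) _ _ fun z => rfl
    have h2 : ∏ y, d (x * y) = ∏ y, d x * a x (d y) := Finset.prod_congr rfl fun y _ => hd x y
    rw [h1, Finset.prod_mul_distrib, ← map_prod, Finset.prod_const,
      Finset.card_univ, ← Nat.card_eq_fintype_card] at h2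
    exact h2
  refine ⟨(b ^ l : M), (b ^ l).2, fun x => ?_⟩
  have h := congrArg (fun m => m ^ l) (hb x)
  simp only [mul_zpow, hl, ← map_zpow] at h
  have h2 := congrArg Subtype.val h
  simp only [Subgroup.coe_mul, ha, hdv] at h2
  have h3 : t x = (b ^ l : M) * (s x * (b ^ l : M) * (s x)⁻¹)⁻¹ * s x := by
    nth_rewrite 1 [h2]
    group
  rw [h3]
  group

/-- A chain of normal subgroups with successive quotients abelian of exponent dividing `p`. -/
structure IsPFiltration (p : ℕ) (C : ℕ → Subgroup H) : Prop where
  normal : ∀ i, (C i).Normal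
  anti : ∀ i, C (i + 1) ≤ C i
  comm : ∀ i, ∀ x ∈ C i, ∀ y ∈ C i, x * y * (y * x)⁻¹ ∈ C (i + 1)
  pow : ∀ i, ∀ x ∈ C i, x ^ p ∈ C (i + 1)

namespace IsPFiltration

variable {p : ℕ} {C : ℕ → Subgroup H}

theorem antitone (hC : IsPFiltration p C) : Antitone C := antitone_nat_of_succ_le hC.anti

theorem map {H' : Type*} [Group H'] (hC : IsPFiltration p C) (f : H →* H')
    (hf : Function.Surjective f) : IsPFiltration p fun i => (C i).map f where
  normal i := (hC.normal i).map f hf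
  anti i := Subgroup.map_mono (hC.anti i)
  comm := by
    rintro i _ ⟨x, hx, rfl⟩ _ ⟨y, hy, rfl⟩
    exact ⟨_, hC.comm i x hx y hy, by simp⟩
  pow := by
    rintro i _ ⟨x, hx, rfl⟩
    exact ⟨_, hC.pow i x hx, by simp⟩

theorem comap {H' : Type*} [Group H'] (hC : IsPFiltration p C) (f : H' →* H) :
    IsPFiltration p fun i => (C i).comap f where
  normal i := (hC.normal i).comap f
  anti i := Subgroup.comap_mono (hC.anti i)
  comm i x hx y hy := by simpa using hC.comm i _ hx _ hy
  pow i x hx := by simpa using hC.pow i _ hx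

theorem quotient_comm (hC : IsPFiltration p C) (i : ℕ) [(C (i + 1)).Normal] :
    ∀ x ∈ (C i).map (QuotientGroup.mk' (C (i + 1))),
      ∀ y ∈ (C i).map (QuotientGroup.mk' (C (i + 1))), x * y = y * x := by
  rintro _ ⟨x, hx, rfl⟩ _ ⟨y, hy, rfl⟩
  rw [← map_mul, ← map_mul, ← mul_inv_eq_one, ← map_inv, ← map_mul]
  exact (QuotientGroup.eq_one_iff _).mpr (hC.comm i x hx y hy)

theorem quotient_pow (hC : IsPFiltration p C) (i : ℕ) [(C (i + 1)).Normal] :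
    ∀ x ∈ (C i).map (QuotientGroup.mk' (C (i + 1))), x ^ p = 1 := by
  rintro _ ⟨x, hx, rfl⟩
  rw [← map_pow]
  exact (QuotientGroup.eq_one_iff _).mpr (hC.pow i x hx)

theorem mem_of_mk_mem (hC : IsPFiltration p C) (i : ℕ) [(C (i + 1)).Normal] {x : H}
    (hx : QuotientGroup.mk' (C (i + 1)) x ∈ (C i).map (QuotientGroup.mk' (C (i + 1)))) :
    x ∈ C i := by
  obtain ⟨y, hy, hxy⟩ := hx
  have h : y⁻¹ * x ∈ C (i + 1) := QuotientGroup.eq.mp hxy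
  simpa using (C i).mul_mem hy (hC.anti i h)

/-- Successive approximation: a map multiplicative modulo `C i` is corrected in `H / C (i + 1)`,
where the image of `C i` is abelian and killed by `p`, and then lifted back by an arbitrary
set-theoretic section. -/
theorem exists_hom (hC : IsPFiltration p C) {n : ℕ} (hn : C n = ⊥) (hp : (Nat.card Q).Coprime p)
    (s : Q → H) (hs : ∀ x y, s x * s y * (s (x * y))⁻¹ ∈ C 0) :
    ∃ t : Q →* H, ∀ x, t x * (s x)⁻¹ ∈ C 0 := by
  have key : ∀ i, ∃ t : Q → H, (∀ x y, t x * t y * (t (x * y))⁻¹ ∈ C i) ∧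
      ∀ x, t x * (s x)⁻¹ ∈ C 0 := by
    intro i
    induction i with
    | zero => exact ⟨s, hs, fun x => by simp⟩
    | succ i ih =>
      obtain ⟨t, ht, hts⟩ := ih
      have := hC.normal i
      have := hC.normal (i + 1)
      set π := QuotientGroup.mk' (C (i + 1)) with hπ
      have hsurj : Function.Surjective π := QuotientGroup.mk'_surjective _
      have := (hC.normal i).map π hsurj
      obtain ⟨t', ht'⟩ := exists_hom_of_abelian_kernel ((C i).map π) (hC.quotient_comm i)
        (hC.quotient_pow i) hp (fun x => π (t x)) fun x y =>
          ⟨_, ht x y, by simp only [map_mul, map_inv]⟩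
      choose r hr using hsurj
      refine ⟨fun x => r (t' x), fun x y => ?_, fun x => ?_⟩
      · rw [← QuotientGroup.eq_one_iff]
        change π _ = 1
        simp [hr]
      · have h1 : r (t' x) * (t x)⁻¹ ∈ C i := by
          refine hC.mem_of_mk_mem i ?_
          simpa only [map_mul, map_inv, hr, ← hπ] using ht' x
        simpa using (C 0).mul_mem (hC.antitone (Nat.zero_le i) h1) (hts x)
  obtain ⟨t, ht, hts⟩ := key n
  refine ⟨MonoidHom.mk' t fun x y => ?_, hts⟩
  have h := ht x y
  rw [hn, Subgroup.mem_bot, mul_inv_eq_one] at h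
  exact h.symm

/-- The same induction, in which only the conjugating element changes: at stage `i` it is multiplied
on the left by an element of `C i`. -/
theorem exists_conj (hC : IsPFiltration p C) {n : ℕ} (hn : C n = ⊥) (hp : (Nat.card Q).Coprime p)
    (s t : Q →* H) (hst : ∀ x, t x * (s x)⁻¹ ∈ C 0) :
    ∃ c ∈ C 0, ∀ x, t x = c * s x * c⁻¹ := by
  have key : ∀ i, ∃ c ∈ C 0, ∀ x, t x * (c * s x * c⁻¹)⁻¹ ∈ C i := by
    intro i
    induction i with
    | zero => exact ⟨1, one_mem _, fun x => by simpa using hst x⟩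
    | succ i ih =>
      obtain ⟨c, hc, ht⟩ := ih
      have := hC.normal i
      have := hC.normal (i + 1)
      set π := QuotientGroup.mk' (C (i + 1)) with hπ
      have hsurj : Function.Surjective π := QuotientGroup.mk'_surjective _
      have := (hC.normal i).map π hsurj
      obtain ⟨_, ⟨d, hd, rfl⟩, hd'⟩ := exists_conj_of_abelian_kernel ((C i).map π)
        (hC.quotient_comm i) (hC.quotient_pow i) hp
        (π.comp ((MulAut.conj c).toMonoidHom.comp s)) (π.comp t) fun x =>
          ⟨_, ht x, by simp⟩
      refine ⟨d * c, mul_mem (hC.antitone (Nat.zero_le i) hd) hc, fun x => ?_⟩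
      rw [← QuotientGroup.eq_one_iff]
      change π _ = 1
      have h := hd' x
      simp only [MonoidHom.comp_apply, ← map_mul, ← map_inv] at h
      rw [map_mul, map_inv, mul_inv_eq_one, h]
      congr 1
      simp [mul_assoc]
  obtain ⟨c, hc, ht⟩ := key n
  refine ⟨c, hc, fun x => ?_⟩
  have h := ht x
  rwa [hn, Subgroup.mem_bot, mul_inv_eq_one] at h

end IsPFiltration

end CoprimeExtensions

/-! ### The congruence filtration on automorphism groups -/

section Congruence

variable {A B : Type*} [CommRing A] [CommRing B] [Algebra A B]

theorem algEquiv_mem_map (γ : B ≃ₐ[A] B) {I : Ideal A} {x : B} (hx : x ∈ I.map (algebraMap A B)) :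
    γ x ∈ I.map (algebraMap A B) := by
  have h := Ideal.mem_map_of_mem (γ : B →+* B) hx
  rw [Ideal.map_map] at h
  have h2 : (γ : B →+* B).comp (algebraMap A B) = algebraMap A B := RingHom.ext fun a => γ.commutes a
  rw [h2] at h
  exact h

variable (B) in
/-- The automorphisms of `B` over `A` which are trivial modulo `I`. -/
def congruenceSubgroup (I : Ideal A) : Subgroup (B ≃ₐ[A] B) where
  carrier := {γ | ∀ F, γ F - F ∈ I.map (algebraMap A B)}
  one_mem' F := by simp
  mul_mem' {γ δ} hγ hδ F := by
    have h := add_mem (hγ (δ F)) (hδ F)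
    rwa [sub_add_sub_cancel] at h
  inv_mem' {γ} hγ F := by
    have h := neg_mem (hγ (γ⁻¹ F))
    have h2 : γ (γ⁻¹ F) = F := γ.apply_symm_apply F
    rwa [h2, neg_sub] at h

theorem congruenceSubgroup_normal (I : Ideal A) : (congruenceSubgroup B I).Normal where
  conj_mem γ hγ δ F := by
    have h := algEquiv_mem_map δ (hγ (δ⁻¹ F))
    have h2 : δ (δ⁻¹ F) = F := δ.apply_symm_apply F
    rwa [map_sub, h2] at h

theorem congruenceSubgroup_mono {I J : Ideal A} (h : I ≤ J) :
    congruenceSubgroup B I ≤ congruenceSubgroup B J := fun _ hγ F => Ideal.map_mono h (hγ F)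

/-- `γ` fixes the image of `A`, so `γ - 1` vanishes on the generators coming from `J`; the twisted
Leibniz rule for `γ - 1` then gains a factor from `I` on their multiples. -/
theorem apply_sub_mem_mul {I J : Ideal A} {γ : B ≃ₐ[A] B} (hγ : γ ∈ congruenceSubgroup B I) {x : B}
    (hx : x ∈ J.map (algebraMap A B)) : γ x - x ∈ (I * J).map (algebraMap A B) := by
  induction hx using Submodule.span_induction with
  | mem x hx =>
    obtain ⟨j, -, rfl⟩ := hx
    simp
  | zero => simp
  | add x y _ _ hx hy =>
    rw [map_add, add_sub_add_comm]
    exact add_mem hx hy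
  | smul b x hx h =>
    have h2 : γ (b • x) - b • x = γ b * (γ x - x) + (γ b - b) * x := by
      rw [smul_eq_mul, map_mul]; ring
    rw [h2]
    refine add_mem (Ideal.mul_mem_left _ _ h) ?_
    rw [Ideal.map_mul]
    exact Ideal.mul_mem_mul (hγ b) hx

theorem isPFiltration_congruenceSubgroup (m : Ideal A) {p : ℕ} (hp : (p : A) ∈ m) :
    IsPFiltration p fun i => congruenceSubgroup B (m ^ (i + 1)) where
  normal i := congruenceSubgroup_normal _
  anti i := congruenceSubgroup_mono (Ideal.pow_le_pow_right (Nat.le_succ _))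
  comm i γ hγ δ hδ F := by
    have hle : m ^ (i + 1) * m ^ (i + 1) ≤ m ^ (i + 1 + 1) := by
      rw [← pow_add]; exact Ideal.pow_le_pow_right (by omega)
    -- For `E = (δ * γ)⁻¹ F` one has `γδE - δγE = (γ - 1)(δ - 1)E - (δ - 1)(γ - 1)E`, and both terms
    -- lie in the square of `m ^ (i + 1)`.
    have h := sub_mem (Ideal.map_mono hle (apply_sub_mem_mul hγ (hδ ((δ * γ)⁻¹ F))))
      (Ideal.map_mono hle (apply_sub_mem_mul hδ (hγ ((δ * γ)⁻¹ F))))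
    have h2 : δ (γ ((δ * γ)⁻¹ F)) = F := (δ * γ).apply_symm_apply F
    rw [map_sub, map_sub, h2] at h
    convert h using 1
    simp only [AlgEquiv.mul_apply]
    ring
  pow i γ hγ F := by
    have hle : m ^ (i + 1) * m ^ (i + 1) ≤ m ^ (i + 1 + 1) := by
      rw [← pow_add]; exact Ideal.pow_le_pow_right (by omega)
    -- Binomial expansion of `(1 + (γ - 1)) ^ n` to first order: two applications of `γ - 1` already
    -- land in `m ^ (i + 2)`. For `n = p` the linear term gains a factor `p ∈ m`.
    have key : ∀ (n : ℕ) (F : B), (γ ^ n) F - F - n * (γ F - F) ∈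
        (m ^ (i + 1 + 1)).map (algebraMap A B) := by
      intro n
      induction n with
      | zero => intro F; simp
      | succ n ih =>
        intro F
        have h := add_mem (ih (γ F)) (Ideal.mul_mem_left _ (n : B)
          (Ideal.map_mono hle (apply_sub_mem_mul hγ (hγ F))))
        convert h using 1
        rw [pow_succ, AlgEquiv.mul_apply, map_sub]
        push_cast
        ring
    have h := key p F
    have h2 : (p : B) * (γ F - F) ∈ (m ^ (i + 1 + 1)).map (algebraMap A B) := by
      rw [pow_succ' m (i + 1), Ideal.map_mul]
      refine Ideal.mul_mem_mul ?_ (hγ F)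
      simpa using Ideal.mem_map_of_mem (algebraMap A B) hp
    simpa using add_mem h h2

theorem congruenceSubgroup_bot : congruenceSubgroup B (⊥ : Ideal A) = ⊥ := by
  refine (Subgroup.eq_bot_iff_forall _).mpr fun γ hγ => AlgEquiv.ext fun F => ?_
  have h := hγ F
  rw [Ideal.map_bot, Ideal.mem_bot, sub_eq_zero] at h
  exact h

/-- Finitely many generators serve all coefficients at once, so the multipliers of each generator
assemble into one power series. -/
theorem powerSeries_mem_map_of_coeff_mem {I : Ideal A} (hI : I.FG) {F : A⟦X⟧}
    (hF : ∀ n, PowerSeries.coeff n F ∈ I) : F ∈ I.map (algebraMap A A⟦X⟧) := by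
  obtain ⟨d, g, rfl⟩ := Submodule.fg_iff_exists_fin_generating_family.mp hI
  choose c hc using fun n => (Submodule.mem_span_range_iff_exists_fun A).mp (hF n)
  have h : F = ∑ i, PowerSeries.mk (fun n => c n i) * algebraMap A A⟦X⟧ (g i) := by
    ext n
    rw [map_sum, ← hc n]
    refine Finset.sum_congr rfl fun i _ => ?_
    rw [mul_comm, ← Algebra.smul_def, PowerSeries.coeff_smul, PowerSeries.coeff_mk, smul_eq_mul,
      smul_eq_mul, mul_comm]
  rw [h]
  exact sum_mem fun i _ => Ideal.mul_mem_left _ _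
    (Ideal.mem_map_of_mem _ (Submodule.subset_span (Set.mem_range_self i)))

end Congruence

/-! ### The kernel of reduction to the residue field. -/

section Residue

variable {p : ℕ} [Fact p.Prime] {k : Type u} [Field k] [CharP k p]

theorem residue_surjective (A : ArtAlg p k) : Function.Surjective A.residue := fun x => by
  obtain ⟨w, hw⟩ := WittVector.constantCoeff_surjective (R := k) p x
  exact ⟨_, (A.residue_algebraMap w).trans hw⟩

theorem ker_residue (A : ArtAlg p k) : RingHom.ker A.residue = IsLocalRing.maximalIdeal A :=
  IsLocalRing.eq_maximalIdeal (RingHom.ker_isMaximal_of_surjective A.residue (residue_surjective A))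

theorem natCast_mem_maximalIdeal (A : ArtAlg p k) : (p : A) ∈ IsLocalRing.maximalIdeal A := by
  rw [← ker_residue, RingHom.mem_ker, map_natCast, CharP.cast_eq_zero]

theorem autMap_residue_eq_one_iff (A : ArtAlg p k) (γ : PSAut A) :
    autMap A.residue γ = 1 ↔ γ ∈ congruenceSubgroup A⟦X⟧ (IsLocalRing.maximalIdeal A) := by
  constructor
  · intro h F
    refine powerSeries_mem_map_of_coeff_mem (IsNoetherian.noetherian _) fun n => ?_
    rw [← ker_residue, RingHom.mem_ker, ← PowerSeries.coeff_map, map_sub, ← autMap_map, h,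
      AlgEquiv.one_apply, sub_self, map_zero]
  · intro h
    refine psAut_ext ?_
    have h2 := Ideal.mem_map_of_mem (PowerSeries.map A.residue) (h PowerSeries.X)
    rw [Ideal.map_map] at h2
    have h3 : (IsLocalRing.maximalIdeal A).map
        ((PowerSeries.map A.residue).comp (algebraMap A A⟦X⟧)) = ⊥ := by
      rw [Ideal.map_eq_bot_iff_le_ker, ← ker_residue]
      intro a ha
      rw [RingHom.mem_ker] at ha ⊢
      rw [RingHom.comp_apply, ← PowerSeries.C_eq_algebraMap, PowerSeries.map_C, ha, map_zero]
    rw [h3, Ideal.mem_bot, map_sub, sub_eq_zero] at h2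
    rw [autMap_X, h2]
    simp

theorem exists_isPFiltration_ker_autMap (A : ArtAlg p k) :
    ∃ (C : ℕ → Subgroup (PSAut A)) (n : ℕ), IsPFiltration p C ∧ C n = ⊥ ∧
      C 0 = (autMap A.residue).ker := by
  obtain ⟨n, hn⟩ := (isArtinianRing_iff_isNilpotent_maximalIdeal A).mp inferInstance
  -- The shift by one makes `C 0` the group of automorphisms trivial modulo `m`, which is the kernel
  -- of reduction; `m ^ n = 0` makes `C n` trivial.
  refine ⟨fun i => congruenceSubgroup A⟦X⟧ (IsLocalRing.maximalIdeal A ^ (i + 1)), n,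
    isPFiltration_congruenceSubgroup _ (natCast_mem_maximalIdeal A), ?_, ?_⟩
  · beta_reduce
    rw [pow_succ, hn, zero_mul, Submodule.zero_eq_bot, congruenceSubgroup_bot]
  · ext γ
    rw [MonoidHom.mem_ker, autMap_residue_eq_one_iff]
    beta_reduce
    rw [zero_add, pow_one]

end Residue

/-! ### Extending and conjugating lifts of homomorphisms -/

section LiftExtension

variable {Γ Γ₀ G : Type*} [Group Γ] [Group Γ₀] [Group G] (q : Γ →* Γ₀) (ρ : G →* Γ₀)
  {N : Subgroup G} [N.Normal] (σ : N →* Γ)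

/-- The pairs `(r, g)` such that `r` lifts `ρ(g)` and conjugation by `r` acts on `σ` as `g` does. -/
def liftNormalizer : Subgroup (Γ × G) where
  carrier := {e | q e.1 = ρ e.2 ∧ ∀ n, e.1 * σ n * e.1⁻¹ = σ (MulAut.conjNormal e.2 n)}
  one_mem' := by simp
  mul_mem' := by
    rintro ⟨r, g⟩ ⟨r', g'⟩ ⟨h1, h2⟩ ⟨h1', h2'⟩
    refine ⟨?_, fun n => ?_⟩
    · change q (r * r') = ρ (g * g')
      rw [map_mul, map_mul]
      exact congrArg₂ _ h1 h1'
    · change r * r' * σ n * (r * r')⁻¹ = σ (MulAut.conjNormal (g * g') n)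
      rw [map_mul, MulAut.mul_apply, ← h2, ← h2']
      group
  inv_mem' := by
    rintro ⟨r, g⟩ ⟨h1, h2⟩
    refine ⟨?_, fun n => ?_⟩
    · change q r⁻¹ = ρ g⁻¹
      rw [map_inv, map_inv]
      exact congrArg _ h1
    · change r⁻¹ * σ n * r⁻¹⁻¹ = σ (MulAut.conjNormal g⁻¹ n)
      have h := h2 (MulAut.conjNormal g⁻¹ n)
      rw [← MulAut.mul_apply, ← map_mul, mul_inv_cancel, map_one, MulAut.one_apply] at h
      rw [← h]
      group

variable {q ρ σ}

/-- The graph of `σ`, as a homomorphism into `liftNormalizer`. -/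
def graphHom (hσ : ∀ n, q (σ n) = ρ n) : N →* liftNormalizer q ρ σ where
  toFun n := ⟨(σ n, n), hσ n, fun m => by
    rw [← map_inv, ← map_mul, ← map_mul]; rfl⟩
  map_one' := by ext <;> simp
  map_mul' x y := by ext <;> simp

variable (hσ : ∀ n, q (σ n) = ρ n)

theorem graphHom_range_normal : (graphHom hσ).range.Normal where
  conj_mem := by
    rintro _ ⟨n, rfl⟩ ⟨⟨r, g⟩, h1, h2⟩
    refine ⟨MulAut.conjNormal g n, ?_⟩
    ext
    · exact (h2 n).symm
    · rfl

/-- A graph element over `1` is trivial, so `liftNormalizer` embeds in the product of `G` and its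
quotient by the graph. This turns identities in the quotient back into identities in `Γ`. -/
theorem eq_of_snd_eq_of_mk_eq {e e' : liftNormalizer q ρ σ} (h : e.1.2 = e'.1.2)
    (h' : (QuotientGroup.mk e : liftNormalizer q ρ σ ⧸ (graphHom hσ).range) = QuotientGroup.mk e') :
    e = e' := by
  obtain ⟨n, hn⟩ := QuotientGroup.eq.mp h'
  have h2 : (n : G) = 1 := by
    have := congrArg (fun x : liftNormalizer q ρ σ => x.1.2) hn
    change (n : G) = e.1.2⁻¹ * e'.1.2 at this
    rw [this, h, inv_mul_cancel]
  have h3 : n = 1 := Subtype.ext h2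
  rw [h3, map_one, eq_comm, inv_mul_eq_one] at hn
  exact hn

theorem mk_mul_graphHom (e : liftNormalizer q ρ σ) (n : N) :
    (QuotientGroup.mk (e * graphHom hσ n) : liftNormalizer q ρ σ ⧸ (graphHom hσ).range) =
      QuotientGroup.mk e :=
  QuotientGroup.mk_mul_of_mem _ ⟨n, rfl⟩

variable {p : ℕ} {C : ℕ → Subgroup Γ}

/-- The filtration induced on the quotient of `liftNormalizer` by the graph of `σ`. -/
def quotientFiltration [(graphHom hσ).range.Normal] (C : ℕ → Subgroup Γ) (i : ℕ) :
    Subgroup (liftNormalizer q ρ σ ⧸ (graphHom hσ).range) :=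
  ((C i).comap ((MonoidHom.fst Γ G).comp (liftNormalizer q ρ σ).subtype)).map
    (QuotientGroup.mk' (graphHom hσ).range)

section

variable [(graphHom hσ).range.Normal]

theorem isPFiltration_quotientFiltration (hC : IsPFiltration p C) :
    IsPFiltration p (quotientFiltration hσ C) :=
  (hC.comap _).map _ (QuotientGroup.mk'_surjective _)

variable (hρ : Function.Injective ρ)
include hρ

theorem quotientFiltration_eq_bot {n : ℕ} (hn : C n = ⊥) : quotientFiltration hσ C n = ⊥ := by
  rw [Subgroup.eq_bot_iff_forall]
  rintro _ ⟨⟨⟨r, g⟩, h1, h2⟩, hr, rfl⟩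
  have hr' : r ∈ C n := hr
  rw [hn, Subgroup.mem_bot] at hr'
  subst hr'
  have hg : g = 1 := hρ (by rw [map_one, ← h1, map_one])
  subst hg
  exact map_one _

/-- An element of `C 0` reduces to `1`, hence lies over `g = 1` because `ρ` is injective.
Corrections made in the quotient therefore lift to pairs that do not move `g`. -/
theorem exists_of_mem_quotientFiltration (h0 : C 0 = q.ker)
    {c : liftNormalizer q ρ σ ⧸ (graphHom hσ).range} (hc : c ∈ quotientFiltration hσ C 0) :
    ∃ e : liftNormalizer q ρ σ, QuotientGroup.mk e = c ∧ q e.1.1 = 1 ∧ e.1.2 = 1 := by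
  obtain ⟨⟨⟨r, g⟩, h1, h2⟩, hr, rfl⟩ := hc
  have hr' : r ∈ C 0 := hr
  rw [h0, MonoidHom.mem_ker] at hr'
  exact ⟨_, rfl, hr', hρ (by rw [map_one]; exact h1.symm.trans hr')⟩

-- Multiplication by a graph element brings `g` to `1` without changing the class, and then `r` lies
-- in `ker q`. So the part of the quotient lying over `1` in `G/N` is the bottom layer of the
-- filtration.
omit hρ in
theorem mk_mem_quotientFiltration (h0 : C 0 = q.ker) (e : liftNormalizer q ρ σ) (he : e.1.2 ∈ N) :
    (QuotientGroup.mk e : liftNormalizer q ρ σ ⧸ (graphHom hσ).range) ∈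
      quotientFiltration hσ C 0 := by
  refine ⟨e * graphHom hσ ⟨e.1.2, he⟩⁻¹, ?_, mk_mul_graphHom hσ e _⟩
  change e.1.1 * σ ⟨e.1.2, he⟩⁻¹ ∈ C 0
  rw [h0, MonoidHom.mem_ker, map_mul, hσ, e.2.1, ← map_mul]
  simp

end

variable [Finite (G ⧸ N)] (hρ : Function.Injective ρ) (hC : IsPFiltration p C) {n : ℕ}
  (hn : C n = ⊥) (h0 : C 0 = q.ker) (hp : (Nat.card (G ⧸ N)).Coprime p)
include hρ hC hn h0 hp hσ

/-- A homomorphism on `N` whose class is invariant under `G` extends to `G`. -/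
theorem exists_extension (hinv : ∀ g, ∃ r, q r = ρ g ∧
    ∀ n, r * σ n * r⁻¹ = σ (MulAut.conjNormal g n)) :
    ∃ τ : G →* Γ, (∀ g, q (τ g) = ρ g) ∧ ∀ n : N, τ n = σ n := by
  have := graphHom_range_normal hσ
  have hl : ∀ g, ∃ e : liftNormalizer q ρ σ, e.1.2 = g := fun g => by
    obtain ⟨r, h1, h2⟩ := hinv g
    exact ⟨⟨(r, g), h1, h2⟩, rfl⟩
  choose l hl using hl
  have hsnd : ∀ x : G ⧸ N, QuotientGroup.mk x.out = x := fun x => QuotientGroup.out_eq' x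
  -- Coset representatives give a set-theoretic section over `G/N`, multiplicative up to the bottom
  -- layer; `t` is a homomorphic section near it.
  obtain ⟨t, ht⟩ := (isPFiltration_quotientFiltration hσ hC).exists_hom
    (quotientFiltration_eq_bot hσ hρ hn) hp
    (fun x : G ⧸ N => (QuotientGroup.mk (l x.out) : liftNormalizer q ρ σ ⧸ (graphHom hσ).range))
    fun x y => by
      refine mk_mem_quotientFiltration hσ h0 (l x.out * l y.out * (l (x * y).out)⁻¹) ?_
      change (l x.out).1.2 * (l y.out).1.2 * ((l (x * y).out).1.2)⁻¹ ∈ N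
      rw [hl, hl, hl, ← QuotientGroup.eq_one_iff]
      simp
  have hex : ∀ g : G, ∃ e : liftNormalizer q ρ σ, e.1.2 = g ∧
      (QuotientGroup.mk e : liftNormalizer q ρ σ ⧸ (graphHom hσ).range) =
        t (QuotientGroup.mk g) := by
    intro g
    obtain ⟨c, hc, -, hc2⟩ := exists_of_mem_quotientFiltration hσ hρ h0 (ht (QuotientGroup.mk g))
    have hmem : (QuotientGroup.mk g : G ⧸ N).out⁻¹ * g ∈ N := by
      rw [← QuotientGroup.eq, hsnd]
    -- `c` lies over `1`, so the first two factors lie over the chosen representative of `gN`; the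
    -- graph factor moves it to `g` within the same class.
    refine ⟨c * l (QuotientGroup.mk g : G ⧸ N).out * graphHom hσ ⟨_, hmem⟩, ?_, ?_⟩
    · change c.1.2 * (l _).1.2 * (_ * g) = g
      rw [hc2, hl, one_mul, mul_inv_cancel_left]
    · rw [mk_mul_graphHom, QuotientGroup.mk_mul, hc, inv_mul_cancel_right]
  choose T hT1 hT2 using hex
  have hmul : ∀ g g', T (g * g') = T g * T g' := fun g g' =>
    eq_of_snd_eq_of_mk_eq hσ
      (by change _ = (T g).1.2 * (T g').1.2; rw [hT1, hT1, hT1])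
      (by rw [QuotientGroup.mk_mul, hT2, hT2, hT2, QuotientGroup.mk_mul, map_mul])
  refine ⟨((MonoidHom.fst Γ G).comp (liftNormalizer q ρ σ).subtype).comp (MonoidHom.mk' T hmul),
    fun g => ?_, fun m => ?_⟩
  · change q (T g).1.1 = ρ g
    rw [(T g).2.1, hT1]
  · have h : T m = graphHom hσ m := eq_of_snd_eq_of_mk_eq hσ (hT1 _) (by
      rw [hT2, (QuotientGroup.eq_one_iff (m : G)).mpr m.2, map_one, eq_comm,
        QuotientGroup.eq_one_iff]
      exact ⟨m, rfl⟩)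
    change (T m).1.1 = σ m
    rw [h]
    rfl

/-- Two lifts of `ρ` which agree on `N` are conjugate. -/
theorem exists_conj_of_eq_on (τ τ' : G →* Γ) (hτ : ∀ g, q (τ g) = ρ g) (hτ' : ∀ g, q (τ' g) = ρ g)
    (hN : ∀ m : N, τ m = σ m) (hN' : ∀ m : N, τ' m = σ m) :
    ∃ c, q c = 1 ∧ ∀ g, τ' g = c * τ g * c⁻¹ := by
  have := graphHom_range_normal hσ
  have hmem : ∀ υ : G →* Γ, (∀ g, q (υ g) = ρ g) → (∀ m : N, υ m = σ m) →
      ∀ g, ((υ.prod (MonoidHom.id G)) g) ∈ liftNormalizer q ρ σ := by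
    intro υ h1 h2 g
    refine ⟨h1 g, fun m => ?_⟩
    rw [← h2, ← h2]
    simp
  -- `g ↦ (υ g, g)` maps `N` into the graph of `σ`, so it descends to a homomorphism from `G/N`;
  -- conjugacy is applied to the two descended maps.
  have hker : ∀ (υ : G →* Γ) (h1 : ∀ g, q (υ g) = ρ g) (h2 : ∀ m : N, υ m = σ m),
      ∀ m ∈ N, ((QuotientGroup.mk' (graphHom hσ).range).comp
        ((υ.prod (MonoidHom.id G)).codRestrict _ (hmem υ h1 h2))) m = 1 := by
    intro υ h1 h2 m hm
    refine (QuotientGroup.eq_one_iff _).mpr ⟨⟨m, hm⟩, Subtype.ext ?_⟩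
    exact Prod.ext (h2 ⟨m, hm⟩).symm rfl
  obtain ⟨c, hc, hconj⟩ := (isPFiltration_quotientFiltration hσ hC).exists_conj
    (quotientFiltration_eq_bot hσ hρ hn) hp (QuotientGroup.lift N _ (hker τ hτ hN))
    (QuotientGroup.lift N _ (hker τ' hτ' hN')) fun x => by
      induction x using QuotientGroup.induction_on with | H g
      refine mk_mem_quotientFiltration hσ h0
        (⟨_, hmem τ' hτ' hN' g⟩ * (⟨_, hmem τ hτ hN g⟩)⁻¹) ?_
      change g * g⁻¹ ∈ N
      rw [mul_inv_cancel]
      exact one_mem _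
  obtain ⟨e, rfl, he1, he2⟩ := exists_of_mem_quotientFiltration hσ hρ h0 hc
  refine ⟨e.1.1, he1, fun g => ?_⟩
  have h : (⟨_, hmem τ' hτ' hN' g⟩ : liftNormalizer q ρ σ) = e * ⟨_, hmem τ hτ hN g⟩ * e⁻¹ :=
    eq_of_snd_eq_of_mk_eq hσ (by change g = e.1.2 * g * e.1.2⁻¹; simp [he2])
      (hconj (QuotientGroup.mk g))
  exact congrArg (fun x : liftNormalizer q ρ σ => x.1.1) h

end LiftExtension

/-! ### Bijectivity of restriction to `N`. -/

section Restriction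

variable {p : ℕ} [Fact p.Prime] {k : Type u} [Field k] [CharP k p]
  {G : Type u} [Group G] [Finite G] (ρ : G →* PSAut k) (N : Subgroup G) [N.Normal]

theorem resInv_bijective (hρ : Function.Injective ρ) (hp : (Nat.card (G ⧸ N)).Coprime p)
    (A : ArtAlg p k) : Function.Bijective ((resInv (p := p) ρ N).app A) := by
  obtain ⟨C, n, hC, hn, h0⟩ := exists_isPFiltration_ker_autMap A
  constructor
  · intro x y hxy
    induction x using Quotient.inductionOn with | _ σ
    induction y using Quotient.inductionOn with | _ τ
    obtain ⟨χ, hχ, h⟩ := Quotient.exact (congrArg Subtype.val hxy)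
    refine Quotient.sound ?_
    -- After conjugation by `χ`, the lift `σ` agrees with `τ` on `N` exactly and not just up to
    -- equivalence.
    obtain ⟨c, hc, hcg⟩ := exists_conj_of_eq_on (q := autMap A.residue) (ρ := ρ)
      (σ := τ.1.comp N.subtype) (fun m => τ.2 m) hρ hC hn h0 hp
      ((MulAut.conj χ).toMonoidHom.comp σ.1) τ.1
      (fun g => by simp [hχ, σ.2]) τ.2 (fun m => (h m).symm) (fun m => rfl)
    refine ⟨c * χ, by rw [map_mul, hc, hχ, one_mul], fun g => (hcg g).trans ?_⟩
    change c * (χ * σ.1 g * χ⁻¹) * c⁻¹ = _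
    group
  · rintro ⟨x, hx⟩
    induction x using Quotient.inductionOn with | _ σ
    obtain ⟨τ, hτ, hτN⟩ := exists_extension (q := autMap A.residue) (ρ := ρ) (σ := σ.1) σ.2 hρ hC
      hn h0 hp fun g => by
        obtain ⟨r, hr⟩ := exists_lift ρ A g
        obtain ⟨χ, hχ, h⟩ := Quotient.exact ((actFun_mk ρ N A g r hr σ).symm.trans
          (hx (QuotientGroup.mk g)))
        -- Invariance of the class provides the required conjugation only up to some `χ` in the
        -- kernel of reduction, which is absorbed into the lift of `ρ(g)`.
        refine ⟨χ * r, by rw [map_mul, hχ, hr, one_mul], fun m => ?_⟩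
        have h2 := h (MulAut.conjNormal g m)
        change _ = χ * (r * σ.1 (MulAut.conjNormal g⁻¹ (MulAut.conjNormal g m)) * r⁻¹) * χ⁻¹ at h2
        rw [← MulAut.mul_apply, ← map_mul, inv_mul_cancel, map_one, MulAut.one_apply] at h2
        rw [h2]
        group
    refine ⟨Quotient.mk _ ⟨τ, hτ⟩, Subtype.ext ?_⟩
    refine congrArg (Quotient.mk _) (Subtype.ext (MonoidHom.ext fun m => ?_))
    exact hτN m

theorem isIso_resInv (hρ : Function.Injective ρ) (hp : (Nat.card (G ⧸ N)).Coprime p) :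
    IsIso (resInv (p := p) ρ N) := by
  rw [NatTrans.isIso_iff_isIso_app]
  intro A
  rw [CategoryTheory.isIso_iff_bijective]
  exact resInv_bijective ρ N hρ hp A

end Restriction

/-! ### Quotients of objects of `𝒞̂` and the pro-Yoneda lemma -/

section ProYoneda

open IsLocalRing

variable {p : ℕ} [Fact p.Prime] {k : Type u} [Field k] [CharP k p]

namespace CompAlg

theorem residue_surjective (R : CompAlg p k) : Function.Surjective R.residue := fun x => by
  obtain ⟨w, hw⟩ := WittVector.constantCoeff_surjective (R := k) p x
  exact ⟨_, (R.residue_algebraMap w).trans hw⟩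

theorem ker_residue (R : CompAlg p k) : RingHom.ker R.residue = maximalIdeal R :=
  eq_maximalIdeal (RingHom.ker_isMaximal_of_surjective R.residue R.residue_surjective)

/-- The map to `k` induced on a quotient. -/
noncomputable def quotientResidue (R : CompAlg p k) {I : Ideal R} (hI : I ≤ maximalIdeal R) :
    R ⧸ I →+* k :=
  Ideal.Quotient.lift I R.residue fun a ha => by
    rw [← RingHom.mem_ker, ker_residue]
    exact hI ha

theorem isLocalRing_quotient (R : CompAlg p k) {I : Ideal R} (hI : I ≤ maximalIdeal R) :
    IsLocalRing (R ⧸ I) :=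
  have : Nontrivial (R ⧸ I) :=
    Ideal.Quotient.nontrivial_iff.mpr (ne_top_of_le_ne_top (maximalIdeal.isMaximal R).ne_top hI)
  IsLocalRing.of_surjective' (Ideal.Quotient.mk I) Ideal.Quotient.mk_surjective

theorem map_mk_maximalIdeal (R : CompAlg p k) (I : Ideal R) [IsLocalRing (R ⧸ I)] :
    (maximalIdeal R).map (Ideal.Quotient.mk I) = maximalIdeal (R ⧸ I) :=
  map_maximalIdeal_of_surjective _ Ideal.Quotient.mk_surjective

theorem _root_.IsPrecomplete.of_surjective {R M M' : Type*} [CommRing R] (I : Ideal R)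
    [AddCommGroup M] [Module R M] [AddCommGroup M'] [Module R M'] [IsPrecomplete I M]
    (f : M →ₗ[R] M') (hf : Function.Surjective f) : IsPrecomplete I M' := by
  rw [← AdicCompletion.of_surjective_iff]
  intro y
  obtain ⟨x, rfl⟩ := AdicCompletion.map_surjective I hf y
  obtain ⟨z, rfl⟩ := AdicCompletion.of_surjective I M x
  exact ⟨f z, (AdicCompletion.map_of I f z).symm⟩

/-- The quotient of an object of `𝒞̂` by a proper ideal. -/
noncomputable def quotient (R : CompAlg p k) (I : Ideal R) (hI : I ≤ maximalIdeal R) :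
    CompAlg p k :=
  letI := R.isLocalRing_quotient hI
  { carrier := R ⧸ I
    isAdicComplete := by
      rw [← map_mk_maximalIdeal]
      -- Separatedness of `R ⧸ I` is Krull's intersection theorem; precompleteness passes along the
      -- surjection from `R`.
      have h : IsPrecomplete (maximalIdeal R) (R ⧸ I) :=
        IsPrecomplete.of_surjective _ (Submodule.mkQ I) (Submodule.mkQ_surjective I)
      exact (IsAdicComplete.map_algebraMap_iff (maximalIdeal R) (R ⧸ I)).mpr { }
    residue := R.quotientResidue hI
    residue_algebraMap := R.residue_algebraMap }

/-- The truncation `R / m^(n+1)`, an object of `𝒞`. -/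
noncomputable def truncation (R : CompAlg p k) (n : ℕ) : ArtAlg p k :=
  -- The exponent `n + 1` keeps the ideal proper; exponent `0` would give the zero ring, which is
  -- not local.
  letI := R.isLocalRing_quotient (Ideal.pow_le_self (I := maximalIdeal R) n.succ_ne_zero)
  { carrier := R ⧸ maximalIdeal R ^ (n + 1)
    isArtinianRing := by
      rw [isArtinianRing_iff_isNilpotent_maximalIdeal, ← map_mk_maximalIdeal]
      exact ⟨n + 1, by rw [← Ideal.map_pow, Ideal.map_quotient_self]; rfl⟩
    residue := R.quotientResidue (Ideal.pow_le_self n.succ_ne_zero)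
    residue_algebraMap := R.residue_algebraMap }

/-- The projection to a truncation. -/
noncomputable def toTruncation (R : CompAlg p k) (n : ℕ) :
    R →ₐ[WittVector p k] R.truncation n :=
  Ideal.Quotient.mkₐ (WittVector p k) (maximalIdeal R ^ (n + 1))

/-- The transition maps between truncations. -/
noncomputable def truncationMap (R : CompAlg p k) {m n : ℕ} (h : m ≤ n) :
    R.truncation n ⟶ R.truncation m :=
  show R ⧸ maximalIdeal R ^ (n + 1) →ₐ[WittVector p k] R ⧸ maximalIdeal R ^ (m + 1) from
    Ideal.Quotient.factorₐ _ (Ideal.pow_le_pow_right (Nat.succ_le_succ h))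

theorem apply_mem_maximalIdeal {R : CompAlg p k} {A : ArtAlg p k} (f : R →ₐ[WittVector p k] A)
    {x : R} (hx : x ∈ maximalIdeal R) : f x ∈ maximalIdeal A := by
  have := isLocalHom_comp f
  exact map_nonunit (f : R →+* A) x hx

/-- Locality of `f` and nilpotence of `m_A` force `f` to kill a power of `m_R`. -/
theorem exists_truncation_factor {R : CompAlg p k} {A : ArtAlg p k}
    (f : R →ₐ[WittVector p k] A) :
    ∃ (n : ℕ) (g : R.truncation n →ₐ[WittVector p k] A), g.comp (R.toTruncation n) = f := by
  obtain ⟨n, hn⟩ := (isArtinianRing_iff_isNilpotent_maximalIdeal A).mp inferInstance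
  have hle : maximalIdeal R ^ (n + 1) ≤ RingHom.ker f := by
    have h1 : (maximalIdeal R).map (f : R →+* A) ≤ maximalIdeal A :=
      Ideal.map_le_iff_le_comap.mpr fun x hx => apply_mem_maximalIdeal f hx
    have h2 : (maximalIdeal R ^ (n + 1)).map (f : R →+* A) = ⊥ := by
      rw [Ideal.map_pow, eq_bot_iff]
      refine (Ideal.pow_right_mono h1 _).trans ?_
      rw [pow_succ, hn, zero_mul]
      exact le_rfl
    exact (Ideal.map_eq_bot_iff_le_ker _).mp h2
  refine ⟨n, Ideal.Quotient.liftₐ _ f hle, ?_⟩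
  exact Ideal.Quotient.liftₐ_comp _ f hle

/-- Homomorphisms into an object of `𝒞̂` are determined by their composites with homomorphisms to
objects of `𝒞`. -/
theorem hom_ext {R : CompAlg p k} {S : Type*} [CommRing S] [Algebra (WittVector p k) S]
    {u v : S →ₐ[WittVector p k] R}
    (h : ∀ (A : ArtAlg p k) (f : R →ₐ[WittVector p k] A), f.comp u = f.comp v) : u = v := by
  refine IsAdicComplete.algHom_ext (maximalIdeal R) fun n => ?_
  have h2 := congrArg (fun w => (Ideal.Quotient.factorₐ (WittVector p k)
    (Ideal.pow_le_pow_right (I := maximalIdeal R) n.le_succ)).comp w)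
    (h (R.truncation n) (R.toTruncation n))
  exact h2

/-- A morphism `h_R → h_S` is composition with a homomorphism `S → R`. -/
theorem exists_comp_eq {R S : CompAlg p k} (T : homFunctor R ⟶ homFunctor S) :
    ∃ u : S →ₐ[WittVector p k] R, ∀ (A : ArtAlg p k) (f : R →ₐ[WittVector p k] A),
      T.app A f = f.comp u := by
  -- Yoneda with the projections to the truncations in place of the identity of `R`, which is not a
  -- point over an object of `𝒞`; naturality makes their images a compatible system.
  let t : ∀ n, S →ₐ[WittVector p k] R ⧸ maximalIdeal R ^ (n + 1) := fun n =>
    T.app (R.truncation n) (R.toTruncation n)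
  have ht : ∀ {m n : ℕ} (h : m ≤ n), (Ideal.Quotient.factorₐ (WittVector p k)
      (Ideal.pow_le_pow_right (Nat.succ_le_succ h))).comp (t n) = t m := by
    intro m n h
    exact (NatTrans.naturality_apply T (R.truncationMap h) (R.toTruncation n)).symm
  -- Reindexing: the limit is taken over all powers of the maximal ideal, including the zeroth.
  let F : ∀ n, S →ₐ[WittVector p k] R ⧸ maximalIdeal R ^ n := fun n =>
    (Ideal.Quotient.factorₐ (WittVector p k) (Ideal.pow_le_pow_right n.le_succ)).comp (t n)
  have hF : ∀ {m n : ℕ} (h : m ≤ n), (Ideal.Quotient.factorₐ (WittVector p k)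
      (Ideal.pow_le_pow_right h)).comp (F n) = F m := by
    intro m n h
    simp only [F]
    rw [← ht h, ← AlgHom.comp_assoc, ← AlgHom.comp_assoc, Ideal.Quotient.factorₐ_comp,
      Ideal.Quotient.factorₐ_comp]
  refine ⟨IsAdicComplete.liftAlgHom (maximalIdeal R) F hF, fun A f => ?_⟩
  obtain ⟨n, g, rfl⟩ := exists_truncation_factor f
  have h1 : (R.toTruncation n).comp (IsAdicComplete.liftAlgHom (maximalIdeal R) F hF) = t n :=
    (IsAdicComplete.mkₐ_comp_liftAlgHom (maximalIdeal R) F hF (n + 1)).trans (ht n.le_succ)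
  rw [AlgHom.comp_assoc, h1]
  exact NatTrans.naturality_apply T (show R.truncation n ⟶ A from g) (R.toTruncation n)

/-- An isomorphism `h_R ≅ h_S` is composition with an isomorphism `S ≃ R`. -/
theorem exists_algEquiv_of_iso {R S : CompAlg p k} (T : homFunctor R ≅ homFunctor S) :
    ∃ u : S ≃ₐ[WittVector p k] R, ∀ (A : ArtAlg p k) (f : R →ₐ[WittVector p k] A),
      T.hom.app A f = f.comp (u : S →ₐ[WittVector p k] R) := by
  obtain ⟨u, hu⟩ := exists_comp_eq T.hom
  obtain ⟨v, hv⟩ := exists_comp_eq T.inv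
  refine ⟨AlgEquiv.ofAlgHom u v (hom_ext fun A f => ?_) (hom_ext fun A f => ?_), hu⟩
  · exact (hv A (f.comp u)).symm.trans ((congrArg (T.inv.app A) (hu A f)).symm.trans
      (Iso.hom_inv_id_app_apply T A f))
  · exact (hu A (f.comp v)).symm.trans ((congrArg (T.hom.app A) (hv A f)).symm.trans
      (Iso.inv_hom_id_app_apply T A f))

end CompAlg

end ProYoneda

/-! ### Versal hulls of pro-representable functors -/

section VersalHull

open IsLocalRing

variable {p : ℕ} [Fact p.Prime] {k : Type u} [Field k] [CharP k p]

/-- The residue field `k`, as an object of `𝒞`. -/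
noncomputable def point (p : ℕ) [Fact p.Prime] (k : Type u) [Field k] [CharP k p] : ArtAlg p k :=
  letI : Algebra (WittVector p k) k := WittVector.constantCoeff.toAlgebra
  { carrier := k
    residue := RingHom.id k
    residue_algebraMap := fun _ => rfl }

/-- The residue map of an object of `𝒞̂`, as a homomorphism of `W(k)`-algebras. -/
noncomputable def CompAlg.toPoint (R : CompAlg p k) : R →ₐ[WittVector p k] point p k :=
  { (show R →+* point p k from R.residue) with commutes' := R.residue_algebraMap }

/-- The residue map of an object of `𝒞`, as a morphism. -/
noncomputable def ArtAlg.toPoint (A : ArtAlg p k) : A ⟶ point p k :=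
  show A →ₐ[WittVector p k] point p k from
    { (show A →+* point p k from A.residue) with commutes' := A.residue_algebraMap }

theorem residue_apply {R : CompAlg p k} {A : ArtAlg p k} (f : R →ₐ[WittVector p k] A) (x : R) :
    A.residue (f x) = R.residue x :=
  DFunLike.congr_fun (residue_unique (A.residue.comp (f : R →+* A)) R.residue
    (fun w => by simp [A.residue_algebraMap]) R.residue_algebraMap) x

theorem residue_apply_hom {R S : CompAlg p k} (u : R →ₐ[WittVector p k] S) (x : R) :
    S.residue (u x) = R.residue x :=
  DFunLike.congr_fun (residue_unique (S.residue.comp (u : R →+* S)) R.residue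
    (fun w => by simp [S.residue_algebraMap]) R.residue_algebraMap) x

theorem hom_point_subsingleton {R : CompAlg p k} (f g : R →ₐ[WittVector p k] point p k) : f = g :=
  AlgHom.ext fun x => (residue_apply f x).trans (residue_apply g x).symm

/-- Smoothness is applied to `A → k`: `D(k)` has at most one element, so the residue map of `R` lies
under every `y`. -/
theorem surjective_of_isSmooth {R : CompAlg p k} {D : ArtAlg p k ⥤ Type u}
    (φ : homFunctor R ⟶ D) (hφ : IsSmooth φ) (hD : Subsingleton (D.obj (point p k)))
    (A : ArtAlg p k) : Function.Surjective (φ.app A) := fun y => by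
  obtain ⟨z, -, hz⟩ := hφ A (point p k) A.toPoint (residue_surjective A) R.toPoint y
    (Subsingleton.elim _ _)
  exact ⟨z, hz⟩

/-- A linear functional on an ideal, with values in `k`, which does not vanish at a given element. -/
theorem exists_functional (A : ArtAlg p k) (J : Ideal A) (x : J)
    (hx : (x : A) ∉ maximalIdeal A * J) :
    ∃ l : J →+ k, (∀ (a : A) (y : J), l (a • y) = A.residue a * l y) ∧ l x ≠ 0 := by
  -- `J / mJ` is a vector space over the residue field in which `x` has nonzero image, so some
  -- functional detects it.
  let _ : Field (A ⧸ maximalIdeal A) := Ideal.Quotient.field _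
  let q := Submodule.mkQ (maximalIdeal A • ⊤ : Submodule A J)
  have hx' : q x ≠ 0 := by
    intro h
    have h2 : x ∈ (maximalIdeal A • ⊤ : Submodule A J) := (Submodule.Quotient.mk_eq_zero _).mp h
    have h3 := Submodule.mem_map_of_mem (f := J.subtype) h2
    rw [Submodule.map_smul'', Submodule.map_top, Submodule.range_subtype] at h3
    exact hx h3
  obtain ⟨l, hl⟩ : ∃ l : Module.Dual (A ⧸ maximalIdeal A) (J ⧸ (maximalIdeal A • ⊤ : Submodule A J)),
      l (q x) ≠ 0 := by
    by_contra! h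
    exact hx' ((Module.forall_dual_apply_eq_zero_iff (A ⧸ maximalIdeal A) _).mp h)
  let r : A ⧸ maximalIdeal A →+* k := Ideal.Quotient.lift _ A.residue fun a ha => by
    rwa [← RingHom.mem_ker, ker_residue]
  refine ⟨(r : (A ⧸ maximalIdeal A) →+ k).comp ((l : _ →+ A ⧸ maximalIdeal A).comp
    (q : J →+ (J ⧸ (maximalIdeal A • ⊤ : Submodule A J)))), fun a y => ?_, fun h => hl ?_⟩
  · change r (l (q (a • y))) = A.residue a * r (l (q y))
    have h : q (a • y) = (Ideal.Quotient.mk (maximalIdeal A) a) • q y := rfl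
    rw [h, map_smul, smul_eq_mul, map_mul]
    rfl
  · exact (map_eq_zero r).mp h

/-- The homomorphism to the dual numbers given by a derivation. -/
noncomputable def homDual (R : CompAlg p k) (d : R →+ k)
    (hd : ∀ x y, d (x * y) = R.residue x * d y + R.residue y * d x)
    (hw : ∀ w, d (algebraMap (WittVector p k) R w) = 0) : R →ₐ[WittVector p k] dual p k :=
  let f : R →+* DualNumber k :=
    { toFun := fun x => (TrivSqZeroExt.inl (R.residue x) + TrivSqZeroExt.inr (d x))
      map_one' := by
        have h := hw 1
        rw [map_one] at h
        simp [h]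
      map_zero' := by simp
      map_add' := fun x y => by ext <;> simp
      map_mul' := fun x y => by ext <;> simp [hd, mul_comm] }
  { (show R →+* dual p k from f) with
    commutes' := fun w => by
      change (TrivSqZeroExt.inl (R.residue (algebraMap (WittVector p k) R w)) +
        TrivSqZeroExt.inr (d (algebraMap (WittVector p k) R w)) : DualNumber k) =
          TrivSqZeroExt.inl (WittVector.constantCoeff w)
      rw [hw, R.residue_algebraMap, TrivSqZeroExt.inr_zero, add_zero] }

theorem homDual_apply (R : CompAlg p k) (d : R →+ k)
    (hd : ∀ x y, d (x * y) = R.residue x * d y + R.residue y * d x)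
    (hw : ∀ w, d (algebraMap (WittVector p k) R w) = 0) (x : R) : homDual R d hd hw x =
      (TrivSqZeroExt.inl (R.residue x) + TrivSqZeroExt.inr (d x) : DualNumber k) := rfl

/-- If composition with `u` is injective on tangent vectors, it is injective on all points. -/
theorem comp_injective_of_tangent {R S : CompAlg p k} (u : R →ₐ[WittVector p k] S)
    (hu : ∀ d d' : S →ₐ[WittVector p k] dual p k, d.comp u = d'.comp u → d = d')
    {A : ArtAlg p k} {f g : S →ₐ[WittVector p k] A} (h : f.comp u = g.comp u) : f = g := by
  -- If `f` and `g` agree modulo `m ^ (i + 1)` but not modulo `m ^ (i + 2)`, a functional applied to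
  -- `f - g` is a nonzero derivation `S → k`, that is, a nonzero tangent vector which `u` kills.
  have key : ∀ i : ℕ, ∀ s, f s - g s ∈ maximalIdeal A ^ (i + 1) := by
    intro i
    induction i with
    | zero =>
      intro s
      rw [zero_add, pow_one, ← ker_residue, RingHom.mem_ker, map_sub, residue_apply, residue_apply,
        sub_self]
    | succ i ih =>
      intro s
      by_contra hs
      rw [pow_succ'] at hs
      obtain ⟨l, hl, hls⟩ := exists_functional A _ ⟨_, ih s⟩ hs
      let δ : S →+ (maximalIdeal A ^ (i + 1) : Ideal A) :=
        { toFun := fun s => ⟨f s - g s, ih s⟩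
          map_zero' := Subtype.ext (by simp)
          map_add' := fun x y => Subtype.ext (by simp [add_sub_add_comm]) }
      have hδ : ∀ x y, δ (x * y) = f x • δ y + g y • δ x := fun x y => Subtype.ext (by
        change f (x * y) - g (x * y) = f x * (f y - g y) + g y * (f x - g x)
        rw [map_mul, map_mul]
        ring)
      have hδu : ∀ x, δ (u x) = 0 := fun x => Subtype.ext (by
        change f.comp u x - g.comp u x = 0
        rw [h, sub_self])
      have hδw : ∀ w, δ (algebraMap (WittVector p k) S w) = 0 := fun w => Subtype.ext (by
        change f _ - g _ = 0
        rw [f.commutes, g.commutes, sub_self])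
      -- The second argument is the zero tangent vector; both have the same composite with `u` since
      -- `f - g` vanishes on its image.
      have h2 := hu
        (homDual S (l.comp δ) (fun x y => by
          rw [AddMonoidHom.comp_apply, hδ, map_add, hl, hl, residue_apply, residue_apply]
          rfl) (fun w => by rw [AddMonoidHom.comp_apply, hδw, map_zero]))
        (homDual S 0 (by simp) (by simp)) (AlgHom.ext fun x => by
          rw [AlgHom.comp_apply, AlgHom.comp_apply, homDual_apply, homDual_apply,
            AddMonoidHom.comp_apply, hδu, map_zero]
          rfl)
      have h3 := DFunLike.congr_fun h2 s
      rw [homDual_apply, homDual_apply] at h3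
      refine hls ?_
      change l (δ s) = 0
      simpa using congrArg TrivSqZeroExt.snd h3
  refine AlgHom.ext fun s => ?_
  obtain ⟨n, hn⟩ := (isArtinianRing_iff_isNilpotent_maximalIdeal A).mp inferInstance
  have h2 := key n s
  rw [pow_succ, hn, zero_mul] at h2
  exact sub_eq_zero.mp h2

/-- A versal hull of a pro-representable functor is an isomorphism. -/
theorem IsVersalHull.isIso {R : CompAlg p k} {D : ArtAlg p k ⥤ Type u} {φ : homFunctor R ⟶ D}
    (hφ : IsVersalHull φ) (hD : IsProRepresentable D) : IsIso φ := by
  obtain ⟨S, ⟨e⟩⟩ := hD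
  rw [NatTrans.isIso_iff_isIso_app]
  intro A
  rw [CategoryTheory.isIso_iff_bijective]
  have hinj : ∀ A, Function.Injective (e.inv.app A) := fun A =>
    ((CategoryTheory.isIso_iff_bijective _).mp inferInstance).injective
  obtain ⟨u, hu⟩ := CompAlg.exists_comp_eq (φ ≫ e.inv)
  have hu' : ∀ (A : ArtAlg p k) (f : R →ₐ[WittVector p k] A), e.inv.app A (φ.app A f) = f.comp u :=
    hu
  -- `D(k)` injects into `h_S(k)`, which is a point, so smoothness gives surjectivity. For
  -- injectivity, the hull is injective on `k[ε]`-points, and this propagates to all points through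
  -- `u`.
  refine ⟨fun f g hfg => ?_, surjective_of_isSmooth φ hφ.1
    ⟨fun x y => hinj _ (hom_point_subsingleton (R := S) _ _)⟩ A⟩
  refine comp_injective_of_tangent u (fun d d' hd => hφ.2.injective (hinj _ ?_)) ?_
  · exact (hu' _ d).trans (hd.trans (hu' _ d').symm)
  · exact (hu' _ f).symm.trans ((congrArg _ hfg).trans (hu' _ g))

end VersalHull

/-! ### Group actions on pro-representable functors -/

section Actions

open IsLocalRing

variable {p : ℕ} [Fact p.Prime] {k : Type u} [Field k] [CharP k p] {Γ : Type*} [Group Γ]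
  {R : CompAlg p k} {D : ArtAlg p k ⥤ Type u} (φ : homFunctor R ⟶ D) (a : Γ →* End D)

theorem bijective_app [IsIso φ] (A : ArtAlg p k) : Function.Bijective (φ.app A) :=
  (CategoryTheory.isIso_iff_bijective _).mp inferInstance

/-- An action of a group on a pro-representable functor is induced by a unique right action on the
representing ring. -/
theorem existsUnique_rightAction [IsIso φ] :
    ∃! α : Γᵐᵒᵖ →* (R ≃ₐ[WittVector p k] R), ∀ (g : Γ) (A : ArtAlg p k)
      (f : R →ₐ[WittVector p k] A),
        φ.app A (f.comp (α (MulOpposite.op g) : R →ₐ[WittVector p k] R)) =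
          (a g).app A (φ.app A f) := by
  have hex : ∀ g, ∃ u : R →ₐ[WittVector p k] R, ∀ (A : ArtAlg p k) (f : R →ₐ[WittVector p k] A),
      φ.app A (f.comp u) = (a g).app A (φ.app A f) := by
    intro g
    obtain ⟨u, hu⟩ := CompAlg.exists_comp_eq (φ ≫ a g ≫ inv φ)
    refine ⟨u, fun A f => ?_⟩
    have h := congrArg (φ.app A) (hu A f)
    refine h.symm.trans ?_
    change ((φ ≫ a g ≫ inv φ) ≫ φ).app A f = _
    rw [Category.assoc, Category.assoc, IsIso.inv_hom_id, Category.comp_id]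
    rfl
  choose u hu using hex
  have hinj : ∀ {v w : R →ₐ[WittVector p k] R}, (∀ (A : ArtAlg p k) (f : R →ₐ[WittVector p k] A),
      φ.app A (f.comp v) = φ.app A (f.comp w)) → v = w := fun h =>
    CompAlg.hom_ext fun A f => (bijective_app φ A).injective (h A f)
  have h1 : u 1 = AlgHom.id _ R := hinj fun A f => by
    rw [hu, map_one]
    rfl
  have hmul : ∀ g h, u (g * h) = (u h).comp (u g) := fun g h => hinj fun A f => by
    refine (hu _ A f).trans ?_
    rw [map_mul]
    refine Eq.trans ?_ (hu g A (f.comp (u h))).symm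
    exact congrArg ((a g).app A) (hu h A f).symm
  -- `R ↦ h_R` is contravariant, so `u` reverses products. A monoid homomorphism from a group lands
  -- in the units, which yields automorphisms.
  let U : Γᵐᵒᵖ →* (R →ₐ[WittVector p k] R) :=
    { toFun := fun g => u g.unop
      map_one' := h1
      map_mul' := fun g h => hmul h.unop g.unop }
  let α : Γᵐᵒᵖ →* (R ≃ₐ[WittVector p k] R) := (AlgEquiv.algHomUnitsEquiv _ _).toMonoidHom.comp
    U.toHomUnits
  have hα : ∀ g, (α (MulOpposite.op g) : R →ₐ[WittVector p k] R) = u g := fun g => rfl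
  refine ⟨α, fun g A f => by rw [hα]; exact hu g A f, fun β hβ => MonoidHom.ext fun g => ?_⟩
  have h : (β g : R →ₐ[WittVector p k] R) = (α g : R →ₐ[WittVector p k] R) := hinj fun A f =>
    (hβ g.unop A f).trans (hu g.unop A f).symm
  exact AlgEquiv.ext fun x => DFunLike.congr_fun h x

variable (α : Γᵐᵒᵖ →* (R ≃ₐ[WittVector p k] R))

theorem coinvariantIdeal_le : coinvariantIdeal R α ≤ maximalIdeal R := by
  refine Ideal.span_le.mpr ?_
  rintro _ ⟨g, x, rfl⟩
  rw [SetLike.mem_coe, ← CompAlg.ker_residue, RingHom.mem_ker, map_sub, sub_eq_zero]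
  exact residue_apply_hom (α g : R →ₐ[WittVector p k] R) x

/-- This identifies the homomorphisms factoring through the coinvariants with the invariant points
of `h_R`. -/
theorem coinvariantIdeal_le_ker_iff {A : Type*} [CommRing A] [Algebra (WittVector p k) A]
    (f : R →ₐ[WittVector p k] A) : coinvariantIdeal R α ≤ RingHom.ker f ↔
      ∀ g : Γ, f.comp (α (MulOpposite.op g) : R →ₐ[WittVector p k] R) = f := by
  constructor
  · intro h g
    refine AlgHom.ext fun x => ?_
    have h2 : f (α (MulOpposite.op g) x - x) = 0 := h (Ideal.subset_span ⟨_, x, rfl⟩)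
    rw [map_sub, sub_eq_zero] at h2
    exact h2
  · intro h
    refine Ideal.span_le.mpr ?_
    rintro _ ⟨g, x, rfl⟩
    change f (α g x - x) = 0
    rw [map_sub, sub_eq_zero]
    exact DFunLike.congr_fun (h g.unop) x

/-- The ring of coinvariants. -/
noncomputable def coinvariants : CompAlg p k :=
  R.quotient (coinvariantIdeal R α) (coinvariantIdeal_le α)

/-- The projection onto the coinvariants. -/
noncomputable def toCoinvariants : R →ₐ[WittVector p k] coinvariants α :=
  Ideal.Quotient.mkₐ (WittVector p k) (coinvariantIdeal R α)

variable {φ a α} (hα : ∀ (g : Γ) (A : ArtAlg p k) (f : R →ₐ[WittVector p k] A),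
  φ.app A (f.comp (α (MulOpposite.op g) : R →ₐ[WittVector p k] R)) = (a g).app A (φ.app A f))

/-- The morphism from `h_R` of the ring of coinvariants to the functor of invariants. -/
noncomputable def coinvariantsHom : homFunctor (coinvariants α) ⟶ invariants D a where
  app A := ↾fun f : coinvariants α →ₐ[WittVector p k] A =>
    (⟨φ.app A (f.comp (toCoinvariants α)), fun g => by
      rw [← hα]
      refine congrArg (φ.app A) (((coinvariantIdeal_le_ker_iff α _).mp fun x hx => ?_) g)
      have h : toCoinvariants α x = 0 := Ideal.Quotient.eq_zero_iff_mem.mpr hx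
      change f (toCoinvariants α x) = 0
      rw [h, map_zero]⟩ : {x : D.obj A // ∀ g, (a g).app A x = x})
  naturality A B h := by
    ext f
    refine Subtype.ext ?_
    exact NatTrans.naturality_apply φ h (AlgHom.comp f (toCoinvariants α))

theorem isIso_coinvariantsHom [IsIso φ] : IsIso (coinvariantsHom hα) := by
  rw [NatTrans.isIso_iff_isIso_app]
  intro A
  rw [CategoryTheory.isIso_iff_bijective]
  constructor
  · intro f g hfg
    have h := (bijective_app φ A).injective (congrArg Subtype.val hfg)
    exact Ideal.Quotient.algHom_ext _ h
  · rintro ⟨x, hx⟩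
    obtain ⟨f, rfl⟩ := (bijective_app φ A).surjective x
    have hf : coinvariantIdeal R α ≤ RingHom.ker (show R →ₐ[WittVector p k] A from f) :=
      (coinvariantIdeal_le_ker_iff α _).mpr fun g =>
        (bijective_app φ A).injective ((hα g A f).trans (hx g))
    exact ⟨Ideal.Quotient.liftₐ _ f hf,
      Subtype.ext (congrArg (φ.app A) (Ideal.Quotient.liftₐ_comp _ f hf))⟩

theorem isProRepresentable_invariants (hD : IsProRepresentable D) (a : Γ →* End D) :
    IsProRepresentable (invariants D a) := by
  obtain ⟨R, ⟨e⟩⟩ := hD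
  obtain ⟨α, hα, -⟩ := existsUnique_rightAction e.hom a
  have := isIso_coinvariantsHom hα
  exact ⟨_, ⟨asIso (coinvariantsHom hα)⟩⟩

end Actions

end LocalDef

/-! ### Assembly of the three assertions. -/

theorem mainTheorem2 (p : ℕ) [Fact p.Prime] (k : Type u) [Field k] [CharP k p] [PerfectRing k p]
    (G : Type u) [Group G] [Finite G] (ρ : G →* PSAut k) (hρ : Function.Injective ρ)
    (N : Subgroup G) [N.Normal] (hp : (Nat.card (G ⧸ N)).Coprime p)
    (hN : IsProRepresentable (subFunctor (p := p) ρ N)) :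
    IsIso (resInv (p := p) ρ N) ∧
    IsProRepresentable (defFunctor (p := p) ρ) ∧
    ∀ (R_G R_N : CompAlg p k) (φ_G : homFunctor R_G ⟶ defFunctor ρ) (φ_N : homFunctor R_N ⟶ subFunctor ρ N),
      IsVersalHull φ_G → IsVersalHull φ_N →
        (∃! α : (G ⧸ N)ᵐᵒᵖ →* (R_N ≃ₐ[WittVector p k] R_N), InducesAction φ_N α) ∧
        ∀ α : (G ⧸ N)ᵐᵒᵖ →* (R_N ≃ₐ[WittVector p k] R_N), InducesAction φ_N α →
          ∃ e : (R_N ⧸ coinvariantIdeal R_N α) ≃ₐ[WittVector p k] R_G,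
            ∀ (A : ArtAlg p k) (f : R_G →ₐ[WittVector p k] A),
              φ_N.app A ((f.comp (e : _ →ₐ[WittVector p k] R_G)).comp
                (Ideal.Quotient.mkₐ (WittVector p k) (coinvariantIdeal R_N α))) =
              (res ρ N).app A (φ_G.app A f) := by
  have hres := isIso_resInv (p := p) ρ N hρ hp
  have hG : IsProRepresentable (defFunctor (p := p) ρ) := by
    obtain ⟨R, ⟨e⟩⟩ := isProRepresentable_invariants hN (act ρ N)
    exact ⟨R, ⟨e ≪≫ (asIso (resInv ρ N)).symm⟩⟩
  refine ⟨hres, hG, fun R_G R_N φ_G φ_N hφ_G hφ_N => ?_⟩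
  have := hφ_G.isIso hG
  have := hφ_N.isIso hN
  refine ⟨existsUnique_rightAction φ_N (act ρ N), fun α hα => ?_⟩
  have := isIso_coinvariantsHom hα
  -- The chain `h_{R_G} ≅ D_G ≅ D_N^{G/N} ≅ h` of the coinvariants of `R_N`; by contravariance it
  -- yields a ring isomorphism from the coinvariants to `R_G`, and its middle factor gives the
  -- compatibility with `res`.
  obtain ⟨e, he⟩ := CompAlg.exists_algEquiv_of_iso
    (asIso φ_G ≪≫ asIso (resInv ρ N) ≪≫ (asIso (coinvariantsHom hα)).symm)
  refine ⟨e, fun A f => ?_⟩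
  have h := congrArg (fun x => Subtype.val ((coinvariantsHom hα).app A x)) (he A f)
  refine h.symm.trans (congrArg Subtype.val
    (?_ : _ = (resInv ρ N).app A (φ_G.app A f)))
  change ((φ_G ≫ resInv ρ N ≫ inv (coinvariantsHom hα)) ≫ coinvariantsHom hα).app A f = _
  rw [Category.assoc, Category.assoc, IsIso.inv_hom_id, Category.comp_id]
  rfl
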